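/- Let $P^{\otimes 5}=\mathbb F_2[x_1,\dots,x_5]$ with $|x_i|=1$, regarded as a module over the mod-2 Steenrod algebra $\mathcal A_2$; let $P_n$ be its part of degree $n$, let $\mathcal H_n=\sum_{i\ge 0}\mathrm{Im}(Sq^{2^i}:P_{n-2^i}\to P_n)$ be the subspace of hit elements, and let $Q_n=(\mathbb F_2\otimes_{\mathcal A_2}P^{\otimes 5})_n=P_n/\mathcal H_n$. Let $Q_n^{0}\subseteq Q_n$ be the subspace spanned by the classes of monomials $x_1^{a_1}\cdots x_5^{a_5}$ of degree $n$ with $a_1\cdots a_5=0$. The weight vector of $X=x_1^{a_1}\cdots x_5^{a_5}$ is $\omega(X)=(\omega_1,\omega_2,\dots)$, where $\omega_k$ is the number of $j$ such that the coefficient of $2^{k-1}$ in the binary expansion of $a_j$ is $1$. Weight vectors (finitely supported sequences $\omega=(\omega_1,\omega_2,\dots)$ of non-negative integers) are ordered left lexicographically, and $\deg\omega=\sum_k 2^{k-1}\omega_k$. For $\deg\omega=n$, let $P_n^{\le\omega}$ (resp. $P_n^{<\omega}$) be the span of the monomials $X$ of degree $n$ with $\omega(X)\le\omega$ (resp. $\omega(X)<\omega$),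 put $$Q_n^{\omega}=P_n^{\le\omega}/\big((\mathcal H_n\cap P_n^{\le\omega})+P_n^{<\omega}\big),$$ and let $Q_n^{\omega^{>0}}\subseteq Q_n^{\omega}$ be its positive part, the subspace of classes represented by linear combinations of monomials in $P_n^{\le\omega}$ in which every variable $x_1,\dots,x_5$ occurs. Let $\widetilde{Sq}{}^0_*:Q_{31}\to Q_{13}$ be Kameko's homomorphism: it sends the class of $\prod_j x_j^{a_j}$ to the class of $\prod_j x_j^{(a_j-1)/2}$ if all $a_j$ are odd, and to $0$ otherwise. **Theorem.** $\widetilde{Sq}{}^0_*$ is surjective, and with $\omega_{(1)}=(1,1,1,1,1)$, $\omega_{(2)}=(3,2,2,2)$, $\omega_{(3)}=(3,4,3,1)$ there is an isomorphism of $\mathbb F_2$-vector spaces $$\mathrm{Ker}(\widetilde{Sq}{}^0_*)\;\cong\; Q_{31}^{0}\,\oplus\,\bigoplus_{j=1}^{3}Q_{31}^{\omega_{(j)}^{>0}}.$$ Moreover, no other weight vector contributes to the kernel: for every weight vector $\omega$ of degree $31$ different from $\omega_{(1)},\omega_{(2)},\omega_{(3)}$, each class in $\mathrm{Ker}(\widetilde{Sq}{}^0_*)$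 that has a representative in $P_{31}^{\le\omega}$ also has a representative in $P_{31}^{<\omega}$. -/

import Mathlib

open scoped DirectSum

noncomputable section

namespace HitProblem

/-- `P^{⊗t} = 𝔽₂[x₁, …, x_t]`, every variable of degree one. -/
abbrev Poly (t : ℕ) : Type := MvPolynomial (Fin t) (ZMod 2)

/-- The total Steenrod square `∑ Sqⁱ Tⁱ`: by the Cartan formula a ring homomorphism, and it sends
a class `x` of degree one to `x + x² T`. -/
def totalSq (t : ℕ) : Poly t →ₐ[ZMod 2] Polynomial (Poly t) :=
  MvPolynomial.aeval fun j =>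
    Polynomial.C (MvPolynomial.X j) + Polynomial.X * Polynomial.C (MvPolynomial.X j ^ 2)

/-- The Steenrod square `Sqⁱ` on `𝔽₂[x₁, …, x_t]`. -/
def Sq (t i : ℕ) : Poly t →ₗ[ZMod 2] Poly t :=
  (Polynomial.lcoeff (Poly t) i).restrictScalars (ZMod 2) ∘ₗ (totalSq t).toLinearMap

/-- `P_n^{⊗t}`, the homogeneous polynomials of degree `n`. -/
abbrev homog (t n : ℕ) : Submodule (ZMod 2) (Poly t) :=
  MvPolynomial.homogeneousSubmodule (Fin t) (ZMod 2) n

/-- The hit (`𝒜₂`-decomposable) elements of degree `n`: the sum of the images of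
`Sq^{2ⁱ} : P_{n - 2ⁱ} → P_n`, `i ≥ 0`. -/
def hit (t n : ℕ) : Submodule (ZMod 2) (Poly t) :=
  Submodule.span (ZMod 2) {G | ∃ i m : ℕ, m + 2 ^ i = n ∧ ∃ F ∈ homog t m, G = Sq t (2 ^ i) F}

/-- `Q_n^{⊗t} = (𝔽₂ ⊗_{𝒜₂} P^{⊗t})_n`. -/
abbrev Q (t n : ℕ) : Type := homog t n ⧸ (hit t n).submoduleOf (homog t n)

/-- The image in `Q_n^{⊗t}` of (the degree `n` part of) a subspace of `P^{⊗t}`. -/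
def imageInQ (t n : ℕ) (V : Submodule (ZMod 2) (Poly t)) : Submodule (ZMod 2) (Q t n) :=
  (V.submoduleOf (homog t n)).map ((hit t n).submoduleOf (homog t n)).mkQ

/-- `(P^{⊗t})⁰`: the span of the monomials in which some variable does not occur. -/
def polyZero (t : ℕ) : Submodule (ZMod 2) (Poly t) :=
  Submodule.span (ZMod 2) {F | ∃ u : Fin t →₀ ℕ, ∏ j, u j = 0 ∧ F = MvPolynomial.monomial u 1}

/-- `(P^{⊗t})^{>0}`: the span of the monomials in which every variable occurs. -/
def polyPos (t : ℕ) : Submodule (ZMod 2) (Poly t) :=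
  Submodule.span (ZMod 2) {F | ∃ u : Fin t →₀ ℕ, 0 < ∏ j, u j ∧ F = MvPolynomial.monomial u 1}

/-- `(Q_n^{⊗t})⁰ = (𝔽₂ ⊗_{𝒜₂} (P^{⊗t})⁰)_n` as a subspace of `Q_n^{⊗t}`; since
`P^{⊗t} = (P^{⊗t})⁰ ⊕ (P^{⊗t})^{>0}` as `𝒜₂`-modules, it is the image of `(P^{⊗t})⁰`. -/
def QZero (t n : ℕ) : Submodule (ZMod 2) (Q t n) := imageInQ t n (polyZero t)

/-- The weight vector of `x^u`: its entry with (zero-based) index `k` is the number of exponents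
whose `k`-th binary digit is one. -/
def weight {t : ℕ} (u : Fin t →₀ ℕ) : ℕ →₀ ℕ :=
  Finsupp.onFinset (Finset.range (∑ j, u j)) (fun k => ∑ j, u j / 2 ^ k % 2) (by
    intro k hk
    obtain ⟨j, -, hj⟩ := Finset.exists_ne_zero_of_sum_ne_zero hk
    rw [Finset.mem_range]
    refine lt_of_lt_of_le ?_ (Finset.single_le_sum (fun i _ => Nat.zero_le (u i))
      (Finset.mem_univ j))
    by_contra! h
    exact hj (by rw [Nat.div_eq_of_lt (lt_of_le_of_lt h Nat.lt_two_pow_self), Nat.zero_mod]))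

/-- `deg ω = ∑ 2^{j-1} ω_j` (indices are shifted by one here). -/
def weightDeg (ω : ℕ →₀ ℕ) : ℕ := ω.sum fun k a => 2 ^ k * a

/-- `(P_n^{⊗t})^{≤ω}`; weight vectors are ordered left lexicographically. -/
def polyLE (t n : ℕ) (ω : ℕ →₀ ℕ) : Submodule (ZMod 2) (Poly t) :=
  Submodule.span (ZMod 2) {F | ∃ u : Fin t →₀ ℕ, ∑ j, u j = n ∧ weightDeg ω = n ∧
    toLex (weight u) ≤ toLex ω ∧ F = MvPolynomial.monomial u 1}

/-- `(P_n^{⊗t})^{<ω}`. -/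
def polyLT (t n : ℕ) (ω : ℕ →₀ ℕ) : Submodule (ZMod 2) (Poly t) :=
  Submodule.span (ZMod 2) {F | ∃ u : Fin t →₀ ℕ, ∑ j, u j = n ∧ weightDeg ω = n ∧
    toLex (weight u) < toLex ω ∧ F = MvPolynomial.monomial u 1}

/-- `(Q_n^{⊗t})^ω = P_n^{≤ω} / ((hit ∩ P_n^{≤ω}) + P_n^{<ω})`. -/
abbrev QWeight (t n : ℕ) (ω : ℕ →₀ ℕ) : Type :=
  polyLE t n ω ⧸ (hit t n ⊓ polyLE t n ω ⊔ polyLT t n ω).submoduleOf (polyLE t n ω)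

/-- `(Q_n^{⊗t})^{ω^{>0}}`: the classes in `(Q_n^{⊗t})^ω` represented by elements of
`P_n^{≤ω} ∩ (P^{⊗t})^{>0}`. -/
def QWeightPos (t n : ℕ) (ω : ℕ →₀ ℕ) : Submodule (ZMod 2) (QWeight t n ω) :=
  ((polyPos t).submoduleOf (polyLE t n ω)).map
    ((hit t n ⊓ polyLE t n ω ⊔ polyLT t n ω).submoduleOf (polyLE t n ω)).mkQ

/-- Kameko's map on polynomials: `∏ x_j^{a_j}` goes to `∏ x_j^{(a_j - 1)/2}` if all `a_j` are odd,
and to zero otherwise. -/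
def kamekoPoly (t : ℕ) : Poly t →ₗ[ZMod 2] Poly t :=
  (MvPolynomial.basisMonomials (Fin t) (ZMod 2)).constr (ZMod 2) fun u =>
    if ∀ j, Odd (u j) then MvPolynomial.monomial (u.mapRange (fun a => (a - 1) / 2) rfl) 1 else 0

theorem kamekoPoly_monomial (t : ℕ) (u : Fin t →₀ ℕ) :
    kamekoPoly t (MvPolynomial.monomial u 1) =
      if ∀ j, Odd (u j) then MvPolynomial.monomial (u.mapRange (fun a => (a - 1) / 2) rfl) 1
      else 0 := by
  have h := (MvPolynomial.basisMonomials (Fin t) (ZMod 2)).constr_basis (ZMod 2) (fun u =>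
    if ∀ j, Odd (u j) then
      (MvPolynomial.monomial (u.mapRange (fun a => (a - 1) / 2) rfl) 1 : Poly t) else 0) u
  simpa [kamekoPoly] using h

theorem kamekoPoly_X_sq_mul (t : ℕ) (i : Fin t) (B : Poly t) :
    kamekoPoly t (MvPolynomial.X i ^ 2 * B) = MvPolynomial.X i * kamekoPoly t B := by
  induction B using MvPolynomial.induction_on' with
  | add p q hp hq => rw [mul_add, map_add, map_add, mul_add, hp, hq]
  | monomial u a =>
    have h1 : (MvPolynomial.monomial u a : Poly t) = a • MvPolynomial.monomial u 1 := by
      rw [MvPolynomial.smul_monomial, smul_eq_mul, mul_one]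
    have h2 : (MvPolynomial.X i ^ 2 * MvPolynomial.monomial u 1 : Poly t) =
        MvPolynomial.monomial (Finsupp.single i 2 + u) 1 := by
      rw [MvPolynomial.X_pow_eq_monomial, MvPolynomial.monomial_mul, one_mul]
    rw [h1, mul_smul_comm, map_smul, map_smul, mul_smul_comm, h2, kamekoPoly_monomial,
      kamekoPoly_monomial]
    congr 1
    have hodd : (∀ j, Odd ((Finsupp.single i 2 + u : Fin t →₀ ℕ) j)) ↔ ∀ j, Odd (u j) := by
      refine forall_congr' fun j => ?_
      rw [Finsupp.add_apply, Finsupp.single_apply]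
      split_ifs <;> simp [Nat.odd_add, show ¬ Odd 2 by decide]
    by_cases h : ∀ j, Odd (u j)
    · rw [if_pos h, if_pos (hodd.2 h), MvPolynomial.X, MvPolynomial.monomial_mul, one_mul]
      refine congrArg (fun v => MvPolynomial.monomial v 1) (Finsupp.ext fun j => ?_)
      have := (h j).pos
      simp only [Finsupp.mapRange_apply, Finsupp.add_apply, Finsupp.single_apply]
      split_ifs <;> omega
    · rw [if_neg h, if_neg (fun h' => h (hodd.1 h')), mul_zero]

theorem kamekoPoly_sq_mul (t : ℕ) (A B : Poly t) :
    kamekoPoly t (A ^ 2 * B) = A * kamekoPoly t B := by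
  induction A using MvPolynomial.induction_on generalizing B with
  | C a =>
    have ha : a ^ 2 = a := by revert a; decide
    rw [← map_pow, ha, MvPolynomial.C_mul', MvPolynomial.C_mul', map_smul]
  | add p q hp hq => rw [CharTwo.add_sq, add_mul, map_add, hp, hq, add_mul]
  | mul_X p n hp =>
    rw [mul_pow, mul_assoc, hp, kamekoPoly_X_sq_mul, mul_assoc]

theorem prod_X_eq (t : ℕ) (S : Finset (Fin t)) :
    (∏ j ∈ S, MvPolynomial.X j : Poly t) =
      MvPolynomial.monomial (∑ j ∈ S, Finsupp.single j 1) 1 := by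
  rw [MvPolynomial.monomial_sum_one]
  rfl

theorem sum_single_apply (t : ℕ) (S : Finset (Fin t)) (i : Fin t) :
    (∑ j ∈ S, Finsupp.single j 1 : Fin t →₀ ℕ) i = if i ∈ S then 1 else 0 := by
  rw [Finsupp.finsetSum_apply]
  simp [Finsupp.single_apply]

theorem kamekoPoly_prod (t : ℕ) (S : Finset (Fin t)) :
    kamekoPoly t (∏ j ∈ S, MvPolynomial.X j) = if S = Finset.univ then 1 else 0 := by
  rw [prod_X_eq, kamekoPoly_monomial]
  have hiff : (∀ j, Odd ((∑ i ∈ S, Finsupp.single i 1 : Fin t →₀ ℕ) j)) ↔ S = Finset.univ := by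
    rw [Finset.eq_univ_iff_forall]
    refine forall_congr' fun j => ?_
    rw [sum_single_apply]
    split_ifs with h <;> simp [h]
  by_cases h : S = Finset.univ
  · rw [if_pos (hiff.2 h), if_pos h, ← MvPolynomial.C_1, ← MvPolynomial.monomial_zero']
    refine congrArg (fun v => MvPolynomial.monomial v 1) (Finsupp.ext fun j => ?_)
    rw [Finsupp.mapRange_apply, sum_single_apply, h]
    simp
  · rw [if_neg (fun h' => h (hiff.1 h')), if_neg h]

theorem kamekoPoly_coeff_prod (t : ℕ) (S : Finset (Fin t)) (a : ℕ) (ha : a ≠ 0) :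
    kamekoPoly t ((totalSq t (∏ j ∈ S, MvPolynomial.X j)).coeff a) = 0 := by
  rw [map_prod]
  simp only [totalSq, MvPolynomial.aeval_X]
  rw [Finset.prod_add, Polynomial.finsetSum_coeff, map_sum]
  refine Finset.sum_eq_zero fun T hT => ?_
  rw [Finset.prod_mul_distrib, Finset.prod_const, ← map_prod, ← map_prod, mul_left_comm,
    ← map_mul, Polynomial.coeff_X_pow_mul', Polynomial.coeff_C]
  split_ifs with h1 h2
  · have hT' : T ≠ Finset.univ := by
      rintro rfl
      have hc : (S \ Finset.univ : Finset (Fin t)).card = 0 := by simp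
      omega
    rw [Finset.prod_pow, mul_comm, kamekoPoly_sq_mul, kamekoPoly_prod, if_neg hT', mul_zero]
  · exact map_zero _
  · exact map_zero _

theorem coeff_sq (t : ℕ) (p : Polynomial (Poly t)) (k : ℕ) :
    (p ^ 2).coeff k = if 2 ∣ k then p.coeff (k / 2) ^ 2 else 0 := by
  rw [← Polynomial.map_frobenius_expand 2 p, Polynomial.coeff_map,
    Polynomial.coeff_expand two_pos]
  split_ifs
  · rfl
  · exact map_zero _

theorem monomial_eq_sq_mul (t : ℕ) (u : Fin t →₀ ℕ) :
    (MvPolynomial.monomial u 1 : Poly t) =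
      (∏ j, MvPolynomial.X j ^ (u j / 2)) ^ 2 *
        ∏ j ∈ Finset.univ.filter (fun j => Odd (u j)), MvPolynomial.X j := by
  rw [MvPolynomial.monomial_eq, MvPolynomial.C_1, one_mul,
    Finsupp.prod_fintype _ _ (fun _ => pow_zero _), ← Finset.prod_pow, Finset.prod_filter,
    ← Finset.prod_mul_distrib]
  refine Finset.prod_congr rfl fun j _ => ?_
  rw [← pow_mul]
  split_ifs with h
  · rw [← pow_succ]
    congr 1
    have := Nat.odd_iff.1 h
    omega
  · rw [mul_one]
    congr 1
    have := Nat.even_iff.1 (Nat.not_odd_iff_even.1 h)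
    omega

theorem Sq_apply (t i : ℕ) (F : Poly t) : Sq t i F = (totalSq t F).coeff i := rfl

theorem totalSq_coeff_zero (t : ℕ) (F : Poly t) : (totalSq t F).coeff 0 = F := by
  induction F using MvPolynomial.induction_on with
  | C a =>
    rw [← MvPolynomial.algebraMap_eq, AlgHom.commutes]
    simp [Polynomial.algebraMap_apply]
  | add p q hp hq => rw [map_add, Polynomial.coeff_add, hp, hq]
  | mul_X p n hp =>
    rw [map_mul, Polynomial.mul_coeff_zero, hp]
    simp [totalSq]

/-- Kameko's map annihilates the odd squares and carries `Sq^{2k}` to `Sq^k`. -/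
theorem kamekoPoly_Sq (t k : ℕ) (F : Poly t) :
    kamekoPoly t (Sq t k F) = if 2 ∣ k then Sq t (k / 2) (kamekoPoly t F) else 0 := by
  induction F using MvPolynomial.induction_on' with
  | add p q hp hq =>
    rw [map_add, map_add, map_add, hp, hq]
    split_ifs
    · rw [map_add]
    · rw [add_zero]
  | monomial u a =>
    have h1 : (MvPolynomial.monomial u a : Poly t) = a • MvPolynomial.monomial u 1 := by
      rw [MvPolynomial.smul_monomial, smul_eq_mul, mul_one]
    rw [h1, map_smul, map_smul, map_smul, map_smul]
    suffices h : kamekoPoly t (Sq t k (MvPolynomial.monomial u 1)) =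
        if 2 ∣ k then Sq t (k / 2) (kamekoPoly t (MvPolynomial.monomial u 1)) else 0 by
      rw [h]
      split_ifs
      · rfl
      · rw [smul_zero]
    rw [monomial_eq_sq_mul]
    generalize (∏ j, MvPolynomial.X j ^ (u j / 2) : Poly t) = G
    generalize Finset.univ.filter (fun j => Odd (u j)) = S
    rw [kamekoPoly_sq_mul, Sq_apply, map_mul, map_pow, mul_comm, Polynomial.coeff_mul, map_sum,
      Finset.sum_eq_single (0, k)]
    · rw [totalSq_coeff_zero, coeff_sq]
      split_ifs with hk
      · rw [mul_comm, kamekoPoly_sq_mul, kamekoPoly_prod]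
        split_ifs
        · rw [mul_one, mul_one, Sq_apply]
        · rw [mul_zero, mul_zero, map_zero]
      · rw [mul_zero, map_zero]
    · rintro ⟨a, b⟩ hab hne
      rw [Finset.HasAntidiagonal.mem_antidiagonal] at hab
      have ha : a ≠ 0 := by
        rintro rfl
        exact hne (by rw [← hab, zero_add])
      rw [coeff_sq]
      dsimp only
      split_ifs
      · rw [mul_comm, kamekoPoly_sq_mul, kamekoPoly_coeff_prod t S a ha, mul_zero]
      · rw [mul_zero, map_zero]
    · intro h
      exact absurd (Finset.HasAntidiagonal.mem_antidiagonal.2 (zero_add k)) h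

theorem kamekoPoly_mem_span (t m : ℕ) {F : Poly t} (hF : F ∈ homog t m) :
    kamekoPoly t F ∈ Submodule.span (ZMod 2)
      {G : Poly t | ∃ v : Fin t →₀ ℕ, m = t + 2 * v.degree ∧ G = MvPolynomial.monomial v 1} := by
  rw [F.as_sum, map_sum]
  refine Submodule.sum_mem _ fun u hu => ?_
  have h1 : (MvPolynomial.monomial u (F.coeff u) : Poly t) =
      F.coeff u • MvPolynomial.monomial u 1 := by
    rw [MvPolynomial.smul_monomial, smul_eq_mul, mul_one]
  rw [h1, map_smul]
  refine Submodule.smul_mem _ _ ?_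
  rw [kamekoPoly_monomial]
  split_ifs with h
  · refine Submodule.subset_span ⟨_, ?_, rfl⟩
    have hd : u.degree = m := by
      by_contra hne
      exact MvPolynomial.mem_support_iff.1 hu
        (((MvPolynomial.mem_homogeneousSubmodule _ _).1 hF).coeff_eq_zero hne)
    rw [← hd, Finsupp.degree_eq_sum, Finsupp.degree_eq_sum, Finset.mul_sum]
    calc ∑ j, u j = ∑ j : Fin t, (1 + 2 * ((u j - 1) / 2)) := by
          refine Finset.sum_congr rfl fun j _ => ?_
          have := Nat.odd_iff.1 (h j)
          omega
      _ = t + ∑ j : Fin t, 2 * ((u j - 1) / 2) := by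
          rw [Finset.sum_add_distrib]
          simp
  · exact Submodule.zero_mem _

theorem kamekoPoly_homog (t n : ℕ) {F : Poly t} (hF : F ∈ homog t (t + 2 * n)) :
    kamekoPoly t F ∈ homog t n := by
  refine Submodule.span_le.2 ?_ (kamekoPoly_mem_span t _ hF)
  rintro _ ⟨v, hv, rfl⟩
  exact MvPolynomial.isHomogeneous_monomial _ (by omega)

theorem kamekoPoly_homog_of_not (t m : ℕ) (h : ∀ n, m ≠ t + 2 * n) {F : Poly t}
    (hF : F ∈ homog t m) : kamekoPoly t F = 0 := by
  have h0 := kamekoPoly_mem_span t m hF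
  rwa [Set.eq_empty_of_forall_notMem (s := {G : Poly t | ∃ v : Fin t →₀ ℕ,
    m = t + 2 * v.degree ∧ G = MvPolynomial.monomial v 1}) (fun _ ⟨v, hv, _⟩ => h _ hv),
    Submodule.span_empty, Submodule.mem_bot] at h0

/-- Kameko's map carries hit elements to hit elements. -/
theorem kamekoPoly_hit (t n : ℕ) {F : Poly t} (hF : F ∈ hit t (t + 2 * n)) :
    kamekoPoly t F ∈ hit t n := by
  induction hF using Submodule.span_induction with
  | zero => rw [map_zero]; exact Submodule.zero_mem _
  | add x y _ _ hx hy => rw [map_add]; exact Submodule.add_mem _ hx hy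
  | smul a x _ hx => rw [map_smul]; exact Submodule.smul_mem _ _ hx
  | mem x hx =>
    obtain ⟨i, m, him, F, hF, rfl⟩ := hx
    rw [kamekoPoly_Sq]
    split_ifs with h2
    · obtain _ | i := i
      · simp at h2
      · rw [show 2 ^ (i + 1) / 2 = 2 ^ i by rw [pow_succ]; omega]
        by_cases hm : ∃ m', m = t + 2 * m'
        · obtain ⟨m', rfl⟩ := hm
          refine Submodule.subset_span ⟨i, m', ?_, _, kamekoPoly_homog t m' hF, rfl⟩
          rw [pow_succ] at him
          omega
        · push Not at hm
          rw [kamekoPoly_homog_of_not t m hm hF, map_zero]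
          exact Submodule.zero_mem _
    · exact Submodule.zero_mem _

/-- Kameko's homomorphism `Q_m^{⊗t} → Q_n^{⊗t}` for `m = t + 2n`, induced by `kamekoPoly`. -/
def kameko (t : ℕ) {m n : ℕ} (h : m = t + 2 * n) : Q t m →ₗ[ZMod 2] Q t n :=
  Submodule.mapQ _ _ ((kamekoPoly t).restrict fun _ hF => kamekoPoly_homog t n (h ▸ hF))
    fun _ hF => kamekoPoly_hit t n (h ▸ hF)

end HitProblem
end

noncomputable section

namespace HitProblem

open Submodule

/-! Write x_S for the product of the variables in S. A monomial of degree 31 arises from 1 by five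
operations F ↦ x_S F²; the sets S are the levels of binary digits of its exponents, and their sizes
form its weight vector. All relations are taken modulo hit elements and monomials of smaller weight
(`hitLower`).

Two facts produce them. By the Cartan formula, Sq^{2k}(x_S F²) is x_S (Sq^k F)² plus terms with a
smaller first level, so a relation survives when a level is prepended (`mulSq_hitLower`). And Sq¹ of
x_B (x_C G²)² moves one variable from the first level to the second, which gives exchange relations
(`add_sum_exchange_mem`); in particular a first level properly contained in the second gives zero
(`mulSq_mem_of_ssubset`).

Since there are only five variables, these relations, with one more from Sq² for the pattern (1,2),
kill every monomial whose consecutive level sizes show one of the patterns (0,>0), (<5,5), (1,2),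
(1,3,≥2), (1,1,1,3), (3,2,4). By arithmetic, every weight of degree 31 with ω₁ ≠ 5 shows such a
pattern, apart from the three exceptional ones (`weight_cases`, `monomial_mem_hitLower`).

If the Kameko image of F is hit, the part of F with all exponents odd is hit modulo monomials with
ω₁ < 5. Hence the kernel is spanned by classes of monomials with ω₁ < 5, and only the three weights
survive (`ker_kameko_eq`). Steenrod squares preserve the set of variables that occur, so the
positive part splits off from Q⁰. The weight filtration of the kernel over Q⁰ then has exactly the
three positive parts as graded pieces (`finrank_sup_imageInQ`), and the isomorphism follows by
comparing dimensions, none of which has to be computed. -/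

/-- The operation `F ↦ (∏_{j ∈ S} x_j) F²`: it prepends the level `S` of binary digits to the
exponents of every monomial. -/
def mulSq {t : ℕ} (S : Finset (Fin t)) : Poly t →ₗ[ZMod 2] Poly t where
  toFun F := (∏ j ∈ S, MvPolynomial.X j) * F ^ 2
  map_add' F G := by rw [CharTwo.add_sq, mul_add]
  map_smul' a F := by
    have ha : a ^ 2 = a := by revert a; decide
    rw [smul_pow, ha, RingHom.id_apply, mul_smul_comm]

theorem mulSq_apply {t : ℕ} (S : Finset (Fin t)) (F : Poly t) :
    mulSq S F = (∏ j ∈ S, MvPolynomial.X j) * F ^ 2 := rfl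

/-- The exponent vector obtained by prepending the level `S` of binary digits. -/
def consExp {t : ℕ} (S : Finset (Fin t)) (u : Fin t →₀ ℕ) : Fin t →₀ ℕ :=
  ∑ j ∈ S, Finsupp.single j 1 + 2 • u

theorem consExp_apply {t : ℕ} (S : Finset (Fin t)) (u : Fin t →₀ ℕ) (j : Fin t) :
    consExp S u j = (if j ∈ S then 1 else 0) + 2 * u j := by
  rw [consExp, Finsupp.add_apply, sum_single_apply, Finsupp.smul_apply, smul_eq_mul]

theorem mulSq_monomial {t : ℕ} (S : Finset (Fin t)) (u : Fin t →₀ ℕ) :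
    mulSq S (MvPolynomial.monomial u 1) = MvPolynomial.monomial (consExp S u) 1 := by
  rw [mulSq_apply, prod_X_eq, MvPolynomial.monomial_pow, MvPolynomial.monomial_mul, one_pow,
    one_mul, consExp]

theorem mulSq_homog {t m : ℕ} (S : Finset (Fin t)) {F : Poly t} (hF : F ∈ homog t m) :
    mulSq S F ∈ homog t (S.card + 2 * m) := by
  refine MvPolynomial.IsHomogeneous.mul ?_ ?_
  · simpa using MvPolynomial.IsHomogeneous.prod S (fun j => (MvPolynomial.X j : Poly t))
      (fun _ => 1) fun j _ => MvPolynomial.isHomogeneous_X _ j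
  · rw [mul_comm]
    exact MvPolynomial.IsHomogeneous.pow hF 2

/-! ### Weights -/

/-- The left lexicographic order on sequences of natural numbers. -/
def wlt (f g : ℕ → ℕ) : Prop := ∃ k, (∀ i < k, f i = g i) ∧ f k < g k

/-- Prepending an entry to a sequence. -/
def wcons (a : ℕ) (f : ℕ → ℕ) : ℕ → ℕ
  | 0 => a
  | k + 1 => f k

theorem wlt_trans {f g h : ℕ → ℕ} (h₁ : wlt f g) (h₂ : wlt g h) : wlt f h := by
  obtain ⟨k, hk, hk'⟩ := h₁
  obtain ⟨l, hl, hl'⟩ := h₂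
  rcases lt_trichotomy k l with h | rfl | h
  · exact ⟨k, fun i hi => (hk i hi).trans (hl i (hi.trans h)), hl k h ▸ hk'⟩
  · exact ⟨k, fun i hi => (hk i hi).trans (hl i hi), hk'.trans hl'⟩
  · exact ⟨l, fun i hi => (hk i (hi.trans h)).trans (hl i hi), (hk l h).symm ▸ hl'⟩

theorem wlt_wcons_of_lt {a b : ℕ} (h : a < b) (f g : ℕ → ℕ) : wlt (wcons a f) (wcons b g) :=
  ⟨0, fun i hi => absurd hi (Nat.not_lt_zero i), h⟩

theorem wlt_wcons {f g : ℕ → ℕ} (h : wlt f g) (a : ℕ) : wlt (wcons a f) (wcons a g) := by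
  obtain ⟨k, hk, hk'⟩ := h
  refine ⟨k + 1, fun i hi => ?_, hk'⟩
  cases i with
  | zero => rfl
  | succ i => exact hk i (Nat.succ_lt_succ_iff.1 hi)

theorem weight_apply {t : ℕ} (u : Fin t →₀ ℕ) (k : ℕ) :
    weight u k = ∑ j, u j / 2 ^ k % 2 := rfl

theorem weight_consExp {t : ℕ} (S : Finset (Fin t)) (u : Fin t →₀ ℕ) :
    ⇑(weight (consExp S u)) = wcons S.card (weight u) := by
  funext k
  cases k with
  | zero =>
    rw [weight_apply, wcons, Finset.card_eq_sum_ones, ← Finset.sum_filter_add_sum_filter_not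
      Finset.univ (· ∈ S)]
    rw [Finset.sum_congr rfl (g := fun _ => 1), Finset.sum_eq_zero (s := Finset.univ.filter (· ∉ S))]
    · simp
    · intro j hj
      rw [consExp_apply, if_neg (Finset.mem_filter.1 hj).2]
      omega
    · intro j hj
      rw [consExp_apply, if_pos (Finset.mem_filter.1 hj).2]
      omega
  | succ k =>
    rw [wcons, weight_apply, weight_apply]
    refine Finset.sum_congr rfl fun j _ => ?_
    rw [pow_succ', ← Nat.div_div_eq_div_mul, consExp_apply]
    congr 2
    split_ifs <;> omega

/-- The span of the monomials of weight below `κ`, in all degrees. -/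
def lower (t : ℕ) (κ : ℕ → ℕ) : Submodule (ZMod 2) (Poly t) :=
  span (ZMod 2) {F | ∃ u : Fin t →₀ ℕ, wlt (weight u) κ ∧ F = MvPolynomial.monomial u 1}

theorem mulSq_lower {t : ℕ} (S : Finset (Fin t)) {κ : ℕ → ℕ} {F : Poly t} (hF : F ∈ lower t κ) :
    mulSq S F ∈ lower t (wcons S.card κ) := by
  induction hF using span_induction with
  | zero => rw [map_zero]; exact zero_mem _
  | add x y _ _ hx hy => rw [map_add]; exact add_mem hx hy
  | smul a x _ hx => rw [map_smul]; exact smul_mem _ _ hx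
  | mem x hx =>
    obtain ⟨u, hu, rfl⟩ := hx
    rw [mulSq_monomial]
    refine subset_span ⟨_, ?_, rfl⟩
    rw [weight_consExp]
    exact wlt_wcons hu _

theorem mem_span_monomials {t : ℕ} (F : Poly t) :
    F ∈ span (ZMod 2) {G : Poly t | ∃ u : Fin t →₀ ℕ, G = MvPolynomial.monomial u 1} := by
  induction F using MvPolynomial.induction_on' with
  | add p q hp hq => exact add_mem hp hq
  | monomial u a =>
    rw [show (MvPolynomial.monomial u a : Poly t) = a • MvPolynomial.monomial u 1 by
      rw [MvPolynomial.smul_monomial, smul_eq_mul, mul_one]]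
    exact smul_mem _ _ (subset_span ⟨u, rfl⟩)

theorem mulSq_mem_lower_of_card_lt {t a : ℕ} {S : Finset (Fin t)} (h : S.card < a) (κ : ℕ → ℕ)
    (F : Poly t) : mulSq S F ∈ lower t (wcons a κ) := by
  refine span_induction (p := fun F _ => mulSq S F ∈ lower t (wcons a κ)) ?_ ?_ ?_ ?_
    (mem_span_monomials F)
  · rintro _ ⟨u, rfl⟩
    rw [mulSq_monomial]
    refine subset_span ⟨_, ?_, rfl⟩
    rw [weight_consExp]
    exact wlt_wcons_of_lt h _ _
  · rw [map_zero]; exact zero_mem _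
  · intro x y _ _ hx hy; rw [map_add]; exact add_mem hx hy
  · intro c x _ hx; rw [map_smul]; exact smul_mem _ _ hx

/-! ### Steenrod squares of `mulSq` -/

theorem totalSq_prod_coeff {t : ℕ} (S : Finset (Fin t)) (a : ℕ) :
    (totalSq t (∏ j ∈ S, MvPolynomial.X j)).coeff a =
      ∑ R ∈ S.powersetCard a, (∏ j ∈ S \ R, MvPolynomial.X j) * (∏ j ∈ R, MvPolynomial.X j) ^ 2 := by
  rw [map_prod]
  simp only [totalSq, MvPolynomial.aeval_X]
  rw [Finset.prod_congr rfl fun j _ => add_comm _ _, Finset.prod_add, Polynomial.finsetSum_coeff,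
    Finset.powersetCard_eq_filter, Finset.sum_filter]
  refine Finset.sum_congr rfl fun R _ => ?_
  rw [Finset.prod_mul_distrib, Finset.prod_const, ← map_prod, ← map_prod, mul_assoc,
    ← map_mul, Polynomial.coeff_X_pow_mul', Polynomial.coeff_C]
  by_cases h : R.card = a
  · rw [if_pos h, if_pos h.le, if_pos (by omega), Finset.prod_pow, mul_comm]
  · rw [if_neg h]
    split_ifs with h1 h2
    · omega
    · rfl
    · rfl

/-- Cartan formula: the total square of F² is the square of that of F, so only even degrees
contribute there, while Sq^i of a squarefree product squares i of its factors. The squared factors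
pass to the next level. -/
theorem Sq_mulSq {t : ℕ} (a : ℕ) (S : Finset (Fin t)) (F : Poly t) :
    Sq t a (mulSq S F) = ∑ p ∈ Finset.HasAntidiagonal.antidiagonal a, if 2 ∣ p.2 then
      ∑ R ∈ S.powersetCard p.1, mulSq (S \ R) ((∏ j ∈ R, MvPolynomial.X j) * Sq t (p.2 / 2) F)
      else 0 := by
  rw [Sq_apply, mulSq_apply, map_mul, map_pow, Polynomial.coeff_mul]
  refine Finset.sum_congr rfl fun p _ => ?_
  rw [coeff_sq]
  split_ifs
  · rw [totalSq_prod_coeff, Finset.sum_mul]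
    refine Finset.sum_congr rfl fun R _ => ?_
    rw [mulSq_apply, Sq_apply, mul_pow, mul_assoc]
  · rw [mul_zero]

theorem Sq_zero {t : ℕ} (F : Poly t) : Sq t 0 F = F := totalSq_coeff_zero t F

/-- Hit elements of degree `n` together with all monomials of weight below `κ`. -/
def hitLower (t n : ℕ) (κ : ℕ → ℕ) : Submodule (ZMod 2) (Poly t) := hit t n ⊔ lower t κ

theorem Sq_mem_hitLower {t n m i : ℕ} (h : m + 2 ^ i = n) (κ : ℕ → ℕ) {F : Poly t}
    (hF : F ∈ homog t m) : Sq t (2 ^ i) F ∈ hitLower t n κ :=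
  mem_sup_left (subset_span ⟨i, m, h, F, hF, rfl⟩)

theorem mulSq_mem_hitLower_of_card_lt {t n a : ℕ} {S : Finset (Fin t)} (h : S.card < a)
    (κ : ℕ → ℕ) (F : Poly t) : mulSq S F ∈ hitLower t n (wcons a κ) :=
  mem_sup_right (mulSq_mem_lower_of_card_lt h κ F)

/-- Doubling the index of the square: Sq^{2^(i+1)}(x_S F²) equals x_S (Sq^{2^i} F)² up to terms in
which some variables have left S, and these have smaller weight already in the first entry. This
lets every relation be proved at the top levels and reused at any depth. -/
theorem mulSq_hitLower {t n : ℕ} (S : Finset (Fin t)) {κ : ℕ → ℕ} {F : Poly t}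
    (hF : F ∈ hitLower t n κ) :
    mulSq S F ∈ hitLower t (S.card + 2 * n) (wcons S.card κ) := by
  obtain ⟨G, hG, H, hH, rfl⟩ := mem_sup.1 hF
  rw [map_add]
  refine add_mem ?_ (mem_sup_right (mulSq_lower S hH))
  induction hG using span_induction with
  | zero => rw [map_zero]; exact zero_mem _
  | add x y hx' hy' hx hy =>
    rw [map_add]
    exact add_mem (hx (mem_sup.2 ⟨x, hx', H, hH, rfl⟩)) (hy (mem_sup.2 ⟨y, hy', H, hH, rfl⟩))
  | smul a x hx' hx =>
    rw [map_smul]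
    exact smul_mem _ _ (hx (mem_sup.2 ⟨x, hx', H, hH, rfl⟩))
  | mem x hx =>
    obtain ⟨i, m, him, F, hFm, rfl⟩ := hx
    have h1 : Sq t (2 ^ (i + 1)) (mulSq S F) ∈ hitLower t (S.card + 2 * n) (wcons S.card κ) :=
      Sq_mem_hitLower (m := S.card + 2 * m) (by rw [← him, pow_succ]; ring) _ (mulSq_homog S hFm)
    -- The pair `(0, 2 ^ (i + 1))` carries the wanted term; in every other pair the removed set `R`
    -- is nonempty.
    rw [Sq_mulSq, ← Finset.add_sum_erase _ _ (show ((0, 2 ^ (i + 1)) : ℕ × ℕ) ∈ _ from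
      Finset.HasAntidiagonal.mem_antidiagonal.2 (zero_add _)), if_pos (by simp [pow_succ])] at h1
    simp only [Finset.powersetCard_zero, Finset.sum_singleton, Finset.prod_empty, one_mul,
      Finset.sdiff_empty] at h1
    rw [show 2 ^ (i + 1) / 2 = 2 ^ i by rw [pow_succ]; omega] at h1
    refine (Submodule.add_mem_iff_left _ (sum_mem fun p hp => ?_)).1 h1
    split_ifs
    · refine sum_mem fun R hR => mulSq_mem_hitLower_of_card_lt ?_ κ _
      obtain ⟨hp0, hp⟩ := Finset.mem_erase.1 hp
      rw [Finset.HasAntidiagonal.mem_antidiagonal] at hp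
      obtain ⟨hRS, hR⟩ := Finset.mem_powersetCard.1 hR
      have h0 : p.1 ≠ 0 := fun h0 => hp0 (Prod.ext h0 (by simpa [h0] using hp))
      have := Finset.card_sdiff_add_card_eq_card hRS
      omega
    · exact zero_mem _

/-! ### Relations between products of two levels -/

theorem X_mul_mulSq_of_notMem {t : ℕ} {b : Fin t} {C : Finset (Fin t)} (h : b ∉ C) (G : Poly t) :
    MvPolynomial.X b * mulSq C G = mulSq (insert b C) G := by
  rw [mulSq_apply, mulSq_apply, Finset.prod_insert h, mul_assoc]

theorem X_mul_mulSq_of_mem {t : ℕ} {b : Fin t} {C : Finset (Fin t)} (h : b ∈ C) (G : Poly t) :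
    MvPolynomial.X b * mulSq C G = mulSq (C.erase b) (MvPolynomial.X b * G) := by
  rw [mulSq_apply, mulSq_apply, ← Finset.mul_prod_erase C _ h]
  ring

/-- The relation given by `Sq¹`. -/
theorem sum_move_mem {t m x y n : ℕ} {B C : Finset (Fin t)} (hB : B.card = x + 1)
    (hC : C.card + 1 = y) (hn : n = x + 2 * (y + 2 * m)) {G : Poly t} (hG : G ∈ homog t m)
    (κ : ℕ → ℕ) :
    ∑ b ∈ B \ C, mulSq (B.erase b) (mulSq (insert b C) G) ∈
      hitLower t n (wcons x (wcons y κ)) := by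
  have h1 : Sq t (2 ^ 0) (mulSq B (mulSq C G)) ∈ hitLower t n (wcons x (wcons y κ)) :=
    Sq_mem_hitLower (m := B.card + 2 * (C.card + 2 * m)) (by rw [hn]; omega) _
      (mulSq_homog B (mulSq_homog C hG))
  have h2 : Sq t (2 ^ 0) (mulSq B (mulSq C G)) =
      ∑ b ∈ B, mulSq (B.erase b) (MvPolynomial.X b * mulSq C G) := by
    rw [pow_zero, Sq_mulSq, show Finset.HasAntidiagonal.antidiagonal 1 = {(0, 1), (1, 0)} from rfl]
    simp [Finset.powersetCard_one, Sq_zero, Finset.sdiff_singleton_eq_erase]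
  rw [h2, ← Finset.sum_sdiff (Finset.inter_subset_left (s₁ := B) (s₂ := C)),
    Finset.sdiff_inter_self_left] at h1
  -- A variable already in `C` carries over to the third level, which leaves `y - 2` elements in the
  -- second: smaller weight.
  have h3 : ∑ b ∈ B ∩ C, mulSq (B.erase b) (MvPolynomial.X b * mulSq C G) ∈
      hitLower t n (wcons x (wcons y κ)) := by
    refine sum_mem fun b hb => ?_
    obtain ⟨hbB, hbC⟩ := Finset.mem_inter.1 hb
    rw [X_mul_mulSq_of_mem hbC]
    refine mem_sup_right ?_
    have hx : (B.erase b).card = x := by rw [Finset.card_erase_of_mem hbB, hB]; rfl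
    rw [← hx]
    refine mulSq_lower _ (mulSq_mem_lower_of_card_lt ?_ _ _)
    rw [Finset.card_erase_of_mem hbC]
    omega
  rw [Submodule.add_mem_iff_left _ h3] at h1
  convert h1 using 1
  refine Finset.sum_congr rfl fun b hb => ?_
  rw [X_mul_mulSq_of_notMem (Finset.mem_sdiff.1 hb).2]

/-- The relation that exchanges `e` in the second level with the elements of the first level. -/
theorem add_sum_exchange_mem {t m n : ℕ} {D E : Finset (Fin t)} {e : Fin t} (heD : e ∉ D)
    (heE : e ∈ E) (hn : n = D.card + 2 * (E.card + 2 * m)) {G : Poly t} (hG : G ∈ homog t m)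
    (κ : ℕ → ℕ) :
    mulSq D (mulSq E G) +
        ∑ d ∈ D \ E, mulSq ((insert e D).erase d) (mulSq (insert d (E.erase e)) G) ∈
      hitLower t n (wcons D.card (wcons E.card κ)) := by
  have h := sum_move_mem (B := insert e D) (C := E.erase e) (x := D.card) (y := E.card)
    (by rw [Finset.card_insert_of_notMem heD]) (Finset.card_erase_add_one heE) hn hG κ
  have h1 : insert e D \ E.erase e = insert e (D \ E) := by
    ext j
    simp only [Finset.mem_sdiff, Finset.mem_insert, Finset.mem_erase]
    by_cases hj : j = e <;> simp [hj]
  rw [h1, Finset.sum_insert (fun h => heD (Finset.mem_sdiff.1 h).1), Finset.erase_insert heD,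
    Finset.insert_erase heE] at h
  exact h

/-- For `e ∈ E \ D` the exchange relation has no further terms, because `D \ E` is empty. -/
theorem mulSq_mem_of_ssubset {t m n : ℕ} {D E : Finset (Fin t)} (h : D ⊂ E)
    (hn : n = D.card + 2 * (E.card + 2 * m)) {G : Poly t} (hG : G ∈ homog t m) (κ : ℕ → ℕ) :
    mulSq D (mulSq E G) ∈ hitLower t n (wcons D.card (wcons E.card κ)) := by
  obtain ⟨e, heE, heD⟩ := Finset.exists_of_ssubset h
  simpa [Finset.sdiff_eq_empty_iff_subset.2 h.1] using add_sum_exchange_mem heD heE hn hG κ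

/-- Exchange when only one element of the first level is missing in the second. -/
theorem add_exchange_mem {t m n : ℕ} {D E : Finset (Fin t)} {d e : Fin t} (heD : e ∉ D)
    (heE : e ∈ E) (hd : D \ E = {d}) (hn : n = D.card + 2 * (E.card + 2 * m)) {G : Poly t}
    (hG : G ∈ homog t m) (κ : ℕ → ℕ) :
    mulSq D (mulSq E G) + mulSq ((insert e D).erase d) (mulSq (insert d (E.erase e)) G) ∈
      hitLower t n (wcons D.card (wcons E.card κ)) := by
  simpa [hd] using add_sum_exchange_mem heD heE hn hG κ

theorem singleton_exchange {t m n : ℕ} {E : Finset (Fin t)} {d e : Fin t} (hd : d ∉ E)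
    (he : e ∈ E) (hn : n = 1 + 2 * (E.card + 2 * m)) {G : Poly t} (hG : G ∈ homog t m)
    (κ : ℕ → ℕ) :
    mulSq {d} (mulSq E G) + mulSq {e} (mulSq (insert d (E.erase e)) G) ∈
      hitLower t n (wcons 1 (wcons E.card κ)) := by
  have hde : d ≠ e := fun h => hd (h ▸ he)
  have h := add_exchange_mem (D := {d}) (E := E) (d := d) (e := e) (by simpa using hde.symm) he
    (by ext j; simp; rintro rfl; exact hd) (by simpa using hn) hG κ
  rwa [show (insert e {d} : Finset (Fin t)).erase d = {e} by
    ext j; simp; constructor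
    · rintro ⟨h1, h2 | h2⟩
      · exact h2
      · exact absurd h2 h1
    · rintro rfl; exact ⟨hde.symm, Or.inl rfl⟩, Finset.card_singleton] at h

/-- The relation given by `Sq²` on `(∏_{j ∈ S} x_j) G⁴`. -/
theorem sum_move_two_mem {t m n x : ℕ} {S : Finset (Fin t)} (hS : S.card = x + 2)
    (hn : n = x + 4 + 4 * m) {G : Poly t} (hG : G ∈ homog t m) (κ : ℕ → ℕ) :
    ∑ R ∈ S.powersetCard 2, mulSq (S \ R) (mulSq R G) ∈ hitLower t n κ := by
  have h1 : Sq t (2 ^ 1) (mulSq S (mulSq ∅ G)) ∈ hitLower t n κ :=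
    Sq_mem_hitLower (m := S.card + 2 * (0 + 2 * m)) (by rw [hn]; omega) _
      (mulSq_homog S (mulSq_homog ∅ hG))
  -- Sq¹ vanishes on squares, which removes the term of Sq² that leaves `S` intact. The relation is
  -- therefore exact, with no lower terms, and `κ` is arbitrary.
  have h2 : Sq t 1 (G ^ 2) = 0 := by
    have h := Sq_mulSq 1 ∅ G
    rw [show Finset.HasAntidiagonal.antidiagonal 1 = {(0, 1), (1, 0)} from rfl] at h
    simpa [Finset.powersetCard_one, mulSq_apply ∅] using h
  rw [pow_one, Sq_mulSq,
    show Finset.HasAntidiagonal.antidiagonal 2 = {(0, 2), (1, 1), (2, 0)} from rfl] at h1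
  simpa [h2, Sq_zero, mulSq_apply ∅, mulSq_apply _ G] using h1

/-! ### Weights in which every monomial is hit modulo lower weights -/

/-- For distinct i, j, k the three ways of putting one variable in the first level and two in the
second are congruent by exchange, and Sq² makes their sum zero. Three being odd, each is zero. -/
theorem mem_of_card_one_two {m n : ℕ} {D E : Finset (Fin 5)} (hD : D.card = 1) (hE : E.card = 2)
    (hn : n = D.card + 2 * (E.card + 2 * m)) {G : Poly 5} (hG : G ∈ homog 5 m) (κ : ℕ → ℕ) :
    mulSq D (mulSq E G) ∈ hitLower 5 n (wcons D.card (wcons E.card κ)) := by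
  obtain ⟨i, rfl⟩ := Finset.card_eq_one.1 hD
  by_cases hi : i ∈ E
  · refine mulSq_mem_of_ssubset (Finset.ssubset_iff_subset_ne.2 ⟨by simpa using hi, ?_⟩) hn hG κ
    rintro rfl
    omega
  obtain ⟨j, k, hjk, rfl⟩ := Finset.card_eq_two.1 hE
  simp only [Finset.mem_insert, Finset.mem_singleton, not_or] at hi
  have hn' : n = 1 + 2 * (({j, k} : Finset (Fin 5)).card + 2 * m) := by rw [hn, hD]
  have h1 := singleton_exchange (d := i) (e := j) (E := {j, k}) (by simpa using hi) (by simp) hn' hG κ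
  have h2 := singleton_exchange (d := i) (e := k) (E := {j, k}) (by simpa using hi) (by simp) hn' hG κ
  have h3 := sum_move_two_mem (S := {i, j, k}) (x := 1) (n := n)
    (Finset.card_eq_three.2 ⟨i, j, k, hi.1, hi.2, hjk, rfl⟩) (by rw [hn, hD, hE]; ring) hG
    (wcons 1 (wcons 2 κ))
  rw [hE] at h1 h2
  rw [hD, hE]
  have e1 : insert i (({j, k} : Finset (Fin 5)).erase j) = {i, k} := by
    rw [Finset.erase_insert (by simpa using hjk)]
  have e2 : insert i (({j, k} : Finset (Fin 5)).erase k) = {i, j} := by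
    rw [Finset.pair_comm, Finset.erase_insert (by simpa using hjk.symm)]
  have e3 : ({i, j, k} : Finset (Fin 5)).powersetCard 2 = {{j, k}, {i, k}, {i, j}} := by
    obtain ⟨hij, hik⟩ := hi
    clear * - hij hik hjk
    decide +revert
  have e4 : ({i, j, k} : Finset (Fin 5)) \ {j, k} = {i} ∧
      ({i, j, k} : Finset (Fin 5)) \ {i, k} = {j} ∧
      ({i, j, k} : Finset (Fin 5)) \ {i, j} = {k} ∧
      ({j, k} : Finset (Fin 5)) ≠ {i, k} ∧ ({j, k} : Finset (Fin 5)) ≠ {i, j} ∧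
      ({i, k} : Finset (Fin 5)) ≠ {i, j} := by
    obtain ⟨hij, hik⟩ := hi
    clear * - hij hik hjk
    decide +revert
  obtain ⟨f1, f2, f3, f4, f5, f6⟩ := e4
  rw [e3, Finset.sum_insert (by simp [f4, f5]), Finset.sum_insert (by simp [f6]),
    Finset.sum_singleton, f1, f2, f3] at h3
  rw [e1] at h1
  rw [e2] at h2
  have h4 := add_mem (add_mem h1 h2) h3
  have h5 : ∀ a b c : Poly 5, a + b + (a + c) + (a + (b + c)) = a := fun a b c => by
    linear_combination CharTwo.add_self_eq_zero a + CharTwo.add_self_eq_zero b +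
      CharTwo.add_self_eq_zero c
  rwa [h5] at h4

theorem mem_of_card_lt_five {m n : ℕ} {D E : Finset (Fin 5)} (hD : D.card < 5) (hE : E.card = 5)
    (hn : n = D.card + 2 * (E.card + 2 * m)) {G : Poly 5} (hG : G ∈ homog 5 m) (κ : ℕ → ℕ) :
    mulSq D (mulSq E G) ∈ hitLower 5 n (wcons D.card (wcons E.card κ)) := by
  obtain rfl : E = Finset.univ := (Finset.card_eq_iff_eq_univ E).1 (by simpa using hE)
  refine mulSq_mem_of_ssubset (Finset.ssubset_univ_iff.2 ?_) hn hG κ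
  rintro rfl
  omega

theorem mem_of_card_zero {t m n : ℕ} {D E : Finset (Fin t)} (hD : D.card = 0) (hE : 0 < E.card)
    (hn : n = D.card + 2 * (E.card + 2 * m)) {G : Poly t} (hG : G ∈ homog t m) (κ : ℕ → ℕ) :
    mulSq D (mulSq E G) ∈ hitLower t n (wcons D.card (wcons E.card κ)) := by
  obtain rfl := Finset.card_eq_zero.1 hD
  exact mulSq_mem_of_ssubset (Finset.empty_ssubset.2 (Finset.card_pos.1 hE)) hn hG κ

/-- Relations between the second and the third level remain valid under the first level. -/
theorem mulSq_mem_of_ssubset' {t m n : ℕ} (S : Finset (Fin t)) {D E : Finset (Fin t)} (h : D ⊂ E)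
    (hn : n = S.card + 2 * (D.card + 2 * (E.card + 2 * m))) {G : Poly t} (hG : G ∈ homog t m)
    (κ : ℕ → ℕ) :
    mulSq S (mulSq D (mulSq E G)) ∈
      hitLower t n (wcons S.card (wcons D.card (wcons E.card κ))) := by
  subst hn
  exact mulSq_hitLower S (mulSq_mem_of_ssubset h rfl hG κ)

/-- If `a ∉ E`, exchanging `a` from the third level into the second gives terms whose second level
properly contains the first level `{a}`. -/
theorem singleton_three_mem_of_mem {m n : ℕ} {a : Fin 5} {E F : Finset (Fin 5)} (hE : E.card = 3)
    (ha : a ∈ F) (hn : n = 1 + 2 * (E.card + 2 * (F.card + 2 * m))) {G : Poly 5}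
    (hG : G ∈ homog 5 m) (κ : ℕ → ℕ) :
    mulSq {a} (mulSq E (mulSq F G)) ∈
      hitLower 5 n (wcons 1 (wcons E.card (wcons F.card κ))) := by
  subst hn
  by_cases haE : a ∈ E
  · refine mulSq_mem_of_ssubset (D := {a}) (Finset.ssubset_iff_subset_ne.2
      ⟨by simpa using haE, ?_⟩) (by simp) (mulSq_homog F hG) _
    rintro rfl
    simp at hE
  have h1 := mulSq_hitLower {a} (add_sum_exchange_mem haE ha rfl hG κ)
  rw [map_add, map_sum, Finset.card_singleton] at h1
  refine (Submodule.add_mem_iff_left _ (sum_mem fun d hd => ?_)).1 h1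
  obtain ⟨hdE, hdF⟩ := Finset.mem_sdiff.1 hd
  have hda : a ≠ d := fun h => haE (h ▸ hdE)
  have hc : ((insert a E).erase d).card = E.card := by
    rw [Finset.card_erase_of_mem (Finset.mem_insert_of_mem hdE), Finset.card_insert_of_notMem haE]
    rfl
  have hcF : (insert d (F.erase a)).card = F.card := by
    rw [Finset.card_insert_of_notMem (fun h => hdF (Finset.mem_of_mem_erase h)),
      Finset.card_erase_add_one ha]
  have h := mulSq_mem_of_ssubset (D := {a}) (E := (insert a E).erase d) (n := 1 + 2 * (E.card +
      2 * (F.card + 2 * m))) (Finset.ssubset_iff_subset_ne.2 ⟨by simp [hda], fun h => ?_⟩)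
    (by rw [hc, ← hcF]; rfl) (mulSq_homog (insert d (F.erase a)) hG) (wcons F.card κ)
  · rwa [hc] at h
  · rw [← h, Finset.card_singleton] at hc
    omega

theorem mem_of_card_one_three {m n : ℕ} {D E F : Finset (Fin 5)} (hD : D.card = 1)
    (hE : E.card = 3) (hF : 2 ≤ F.card)
    (hn : n = D.card + 2 * (E.card + 2 * (F.card + 2 * m))) {G : Poly 5} (hG : G ∈ homog 5 m)
    (κ : ℕ → ℕ) :
    mulSq D (mulSq E (mulSq F G)) ∈
      hitLower 5 n (wcons D.card (wcons E.card (wcons F.card κ))) := by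
  obtain ⟨a, rfl⟩ := Finset.card_eq_one.1 hD
  rw [hD] at hn ⊢
  by_cases haF : a ∈ F
  · exact singleton_three_mem_of_mem hE haF hn hG κ
  by_cases haE : a ∈ E
  · have h := mulSq_mem_of_ssubset (D := {a}) (E := E) (n := n) (Finset.ssubset_iff_subset_ne.2
      ⟨by simpa using haE, fun h => by rw [← h] at hE; simp at hE⟩) (by rw [hn, hD])
      (mulSq_homog F hG) (wcons F.card κ)
    rwa [hD] at h
  -- `insert a E` has four of the five elements and `F` at least two, while `a ∉ F`. Exchanging `a`
  -- with `f` then makes the first level a subset of `F`.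
  obtain ⟨f, hfF, hfE⟩ : ∃ f ∈ F, f ∈ E := by
    by_contra! h
    have h1 : Disjoint F (insert a E) := Finset.disjoint_left.2 fun f hf hf' => by
      rcases Finset.mem_insert.1 hf' with rfl | hf'
      · exact haF hf
      · exact h f hf hf'
    have h2 := Finset.card_le_univ (F ∪ insert a E)
    rw [Finset.card_union_of_disjoint h1, Finset.card_insert_of_notMem haE, Fintype.card_fin] at h2
    omega
  have h1 := singleton_exchange haE hfE hn (mulSq_homog F hG) (wcons F.card κ)
  refine (Submodule.add_mem_iff_left _ ?_).1 h1
  have hc : (insert a (E.erase f)).card = E.card := by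
    rw [Finset.card_insert_of_notMem (fun h => haE (Finset.mem_of_mem_erase h)),
      Finset.card_erase_add_one hfE]
  have h2 := singleton_three_mem_of_mem (E := insert a (E.erase f)) (n := n) (by rw [hc, hE]) hfF
    (by rw [hc, hn]) hG κ
  rwa [hc] at h2

/-- Exchanging `w` between the first two levels leaves second levels that avoid `w`, hence lie
properly in the third level. -/
theorem three_two_four_mem_of_notMem {m n : ℕ} {D E : Finset (Fin 5)} {w : Fin 5}
    (hwD : w ∉ D) (hwE : w ∈ E) (hE : E.card = 2)
    (hn : n = D.card + 2 * (E.card + 2 * ((Finset.univ.erase w).card + 2 * m))) {G : Poly 5}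
    (hG : G ∈ homog 5 m) (κ : ℕ → ℕ) :
    mulSq D (mulSq E (mulSq (Finset.univ.erase w) G)) ∈
      hitLower 5 n (wcons D.card (wcons E.card (wcons (Finset.univ.erase w).card κ))) := by
  have h1 := add_sum_exchange_mem hwD hwE hn (mulSq_homog _ hG)
    (wcons (Finset.univ.erase w).card κ)
  refine (Submodule.add_mem_iff_left _ (sum_mem fun d hd => ?_)).1 h1
  obtain ⟨hdD, hdE⟩ := Finset.mem_sdiff.1 hd
  have hc : ((insert w D).erase d).card = D.card := by
    rw [Finset.card_erase_of_mem (Finset.mem_insert_of_mem hdD), Finset.card_insert_of_notMem hwD]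
    rfl
  have hcE : (insert d (E.erase w)).card = E.card := by
    rw [Finset.card_insert_of_notMem (fun h => hdE (Finset.mem_of_mem_erase h)),
      Finset.card_erase_add_one hwE]
  have h := mulSq_mem_of_ssubset' ((insert w D).erase d) (D := insert d (E.erase w))
    (E := Finset.univ.erase w) (n := n) (Finset.ssubset_iff_subset_ne.2 ⟨fun j hj => ?_, fun h => ?_⟩)
    (by rw [hc, hcE, hn]) hG κ
  · rwa [hc, hcE] at h
  · rw [Finset.mem_erase]
    refine ⟨?_, Finset.mem_univ _⟩
    rintro rfl
    rcases Finset.mem_insert.1 hj with rfl | hj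
    · exact hwD hdD
    · simp at hj
  · rw [h, Finset.card_erase_of_mem (Finset.mem_univ _), Finset.card_univ, Fintype.card_fin] at hcE
    omega

theorem mem_of_card_three_two_four {m n : ℕ} {D E F : Finset (Fin 5)} (hD : D.card = 3)
    (hE : E.card = 2) (hF : F.card = 4)
    (hn : n = D.card + 2 * (E.card + 2 * (F.card + 2 * m))) {G : Poly 5} (hG : G ∈ homog 5 m)
    (κ : ℕ → ℕ) :
    mulSq D (mulSq E (mulSq F G)) ∈
      hitLower 5 n (wcons D.card (wcons E.card (wcons F.card κ))) := by
  by_cases hEF : E ⊆ F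
  · exact mulSq_mem_of_ssubset' D (Finset.ssubset_iff_subset_ne.2 ⟨hEF, fun h => by
      rw [h] at hE; omega⟩) hn hG κ
  obtain ⟨w, hwE, hwF⟩ := Finset.not_subset.1 hEF
  obtain rfl : F = Finset.univ.erase w := Finset.eq_of_subset_of_card_le
    (fun j hj => Finset.mem_erase.2 ⟨fun h => hwF (h ▸ hj), Finset.mem_univ _⟩)
    (by rw [hF, Finset.card_erase_of_mem (Finset.mem_univ _), Finset.card_univ]; rfl)
  by_cases hwD : w ∈ D
  swap
  · exact three_two_four_mem_of_notMem hwD hwE hE hn hG κ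
  -- Sizes 3 and 2 with the common element `w` cannot cover five variables. Exchanging `w` with `v`
  -- between the second and third levels reduces to the previous lemma with `v` as the missing
  -- variable.
  obtain ⟨v, hv⟩ : ∃ v, v ∉ D ∪ E := by
    by_contra! h
    have h1 := Finset.card_union_add_card_inter D E
    rw [Finset.eq_univ_iff_forall.2 h, Finset.card_univ, Fintype.card_fin, hD, hE] at h1
    have h2 : 0 < (D ∩ E).card := Finset.card_pos.2 ⟨w, Finset.mem_inter.2 ⟨hwD, hwE⟩⟩
    omega
  rw [Finset.mem_union, not_or] at hv
  have hvw : v ≠ w := fun h => hv.2 (h ▸ hwE)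
  have hd : E \ Finset.univ.erase w = {w} := by
    ext j
    simp only [Finset.mem_sdiff, Finset.mem_erase, Finset.mem_univ, and_true, not_not,
      Finset.mem_singleton]
    exact ⟨fun h => h.2, fun h => ⟨h ▸ hwE, h⟩⟩
  have h1 := mulSq_hitLower D (add_exchange_mem (D := E) (E := Finset.univ.erase w) (d := w) hv.2
    (Finset.mem_erase.2 ⟨hvw, Finset.mem_univ _⟩) hd rfl hG κ)
  rw [← hn, map_add] at h1
  refine (Submodule.add_mem_iff_left _ ?_).1 h1
  have hs : insert w ((Finset.univ.erase w).erase v) = Finset.univ.erase v := by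
    ext j
    by_cases hj : j = w
    · simp [hj, hvw.symm]
    · simp [hj]
  have hc : ((insert v E).erase w).card = E.card := by
    rw [Finset.card_erase_of_mem (Finset.mem_insert_of_mem hwE), Finset.card_insert_of_notMem hv.2]
    rfl
  have hcF : (Finset.univ.erase v).card = (Finset.univ.erase w).card := by
    rw [Finset.card_erase_of_mem (Finset.mem_univ _), Finset.card_erase_of_mem (Finset.mem_univ _)]
  have h2 := three_two_four_mem_of_notMem (D := D) (E := (insert v E).erase w) (w := v) (n := n)
    hv.1 (by simp [hvw]) (by rw [hc, hE]) (by rw [hc, hcF, hn]) hG κ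
  rwa [hc, hcF, ← hs] at h2

/-! ### The weight `(1, 1, 1, 3)` -/

section OneOneOneThree

variable {m n : ℕ} {G : Poly 5} {E : Finset (Fin 5)} {a b c : Fin 5}

theorem swap_first_mem (hab : a ≠ b) (hE : E.card = 3) (hG : G ∈ homog 5 m) (κ : ℕ → ℕ)
    (hn : n = 7 + 8 * (3 + 2 * m)) :
    mulSq {a} (mulSq {b} (mulSq {c} (mulSq E G))) +
        mulSq {b} (mulSq {a} (mulSq {c} (mulSq E G))) ∈
      hitLower 5 n (wcons 1 (wcons 1 (wcons 1 (wcons 3 κ)))) := by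
  have h := singleton_exchange (d := a) (e := b) (E := {b}) (n := n) (by simpa using hab) (by simp)
    (by simp only [Finset.card_singleton]; rw [hn, hE]; ring)
    (mulSq_homog {c} (mulSq_homog E hG)) (wcons 1 (wcons 3 κ))
  simpa using h

theorem swap_second_mem (hbc : b ≠ c) (hE : E.card = 3) (hG : G ∈ homog 5 m) (κ : ℕ → ℕ)
    (hn : n = 7 + 8 * (3 + 2 * m)) :
    mulSq {a} (mulSq {b} (mulSq {c} (mulSq E G))) +
        mulSq {a} (mulSq {c} (mulSq {b} (mulSq E G))) ∈
      hitLower 5 n (wcons 1 (wcons 1 (wcons 1 (wcons 3 κ)))) := by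
  have h := mulSq_hitLower {a} (singleton_exchange (d := b) (e := c) (E := {c}) (by simpa using hbc)
    (by simp) rfl (mulSq_homog E hG) (wcons 3 κ))
  have e : ({a} : Finset (Fin 5)).card + 2 * (1 + 2 * (({c} : Finset (Fin 5)).card +
      2 * (E.card + 2 * m))) = n := by
    rw [hE, hn]; simp only [Finset.card_singleton]; ring
  rw [e] at h
  simpa using h

theorem swap_third_mem {e : Fin 5} (hc : c ∉ E) (he : e ∈ E) (hE : E.card = 3)
    (hG : G ∈ homog 5 m) (κ : ℕ → ℕ) (hn : n = 7 + 8 * (3 + 2 * m)) :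
    mulSq {a} (mulSq {b} (mulSq {c} (mulSq E G))) +
        mulSq {a} (mulSq {b} (mulSq {e} (mulSq (insert c (E.erase e)) G))) ∈
      hitLower 5 n (wcons 1 (wcons 1 (wcons 1 (wcons 3 κ)))) := by
  have h := mulSq_hitLower {a} (mulSq_hitLower {b} (singleton_exchange hc he rfl hG κ))
  have e : ({a} : Finset (Fin 5)).card + 2 * (({b} : Finset (Fin 5)).card +
      2 * (1 + 2 * (E.card + 2 * m))) = n := by
    rw [hE, hn]; simp only [Finset.card_singleton]; ring
  rw [e, hE] at h
  simpa using h

/-- Adjacent singleton levels commute, so the element of `E` can be moved next to `E`, where it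
forms a proper subset. -/
theorem one_one_one_three_mem_of_mem (h : a ∈ E ∨ b ∈ E ∨ c ∈ E) (hE : E.card = 3)
    (hG : G ∈ homog 5 m) (κ : ℕ → ℕ) (hn : n = 7 + 8 * (3 + 2 * m)) :
    mulSq {a} (mulSq {b} (mulSq {c} (mulSq E G))) ∈
      hitLower 5 n (wcons 1 (wcons 1 (wcons 1 (wcons 3 κ)))) := by
  have third : ∀ {a b c : Fin 5}, c ∈ E → mulSq {a} (mulSq {b} (mulSq {c} (mulSq E G))) ∈
      hitLower 5 n (wcons 1 (wcons 1 (wcons 1 (wcons 3 κ)))) := by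
    intro a b c hc
    have h := mulSq_hitLower {a} (mulSq_mem_of_ssubset' {b} (D := {c}) (E := E)
      (Finset.ssubset_iff_subset_ne.2 ⟨by simpa using hc, fun h => by
        rw [← h] at hE; simp at hE⟩) rfl hG κ)
    have e : ({a} : Finset (Fin 5)).card + 2 * (({b} : Finset (Fin 5)).card +
        2 * (({c} : Finset (Fin 5)).card + 2 * (E.card + 2 * m))) = n := by
      rw [hE, hn]; simp only [Finset.card_singleton]; ring
    rw [e, hE] at h
    simpa using h
  have second : ∀ {a b c : Fin 5}, b ∈ E → mulSq {a} (mulSq {b} (mulSq {c} (mulSq E G))) ∈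
      hitLower 5 n (wcons 1 (wcons 1 (wcons 1 (wcons 3 κ)))) := by
    intro a b c hb
    by_cases hbc : b = c
    · exact third (hbc ▸ hb)
    · exact (Submodule.add_mem_iff_left _ (third hb)).1 (swap_second_mem hbc hE hG κ hn)
  rcases h with ha | hb | hc
  · by_cases hab : a = b
    · exact second (hab ▸ ha)
    · exact (Submodule.add_mem_iff_left _ (second ha)).1 (swap_first_mem hab hE hG κ hn)
  · exact second hb
  · exact third hc

/-- Three distinct singletons disjoint from `E` would need six variables, so outside the previous
lemma two of them coincide. After commuting, these are the second and third levels (`diag`);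
exchanging the third with an element of `E` puts the repeated variable into the fourth level while
it stays in the second. -/
theorem one_one_one_three_mem (hE : E.card = 3) (hG : G ∈ homog 5 m) (κ : ℕ → ℕ)
    (hn : n = 7 + 8 * (3 + 2 * m)) :
    mulSq {a} (mulSq {b} (mulSq {c} (mulSq E G))) ∈
      hitLower 5 n (wcons 1 (wcons 1 (wcons 1 (wcons 3 κ)))) := by
  have diag : ∀ {a b : Fin 5}, mulSq {a} (mulSq {b} (mulSq {b} (mulSq E G))) ∈
      hitLower 5 n (wcons 1 (wcons 1 (wcons 1 (wcons 3 κ)))) := by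
    intro a b
    by_cases hb : b ∈ E
    · exact one_one_one_three_mem_of_mem (.inr (.inl hb)) hE hG κ hn
    obtain ⟨e, he⟩ := Finset.card_pos.1 (by omega : 0 < E.card)
    refine (Submodule.add_mem_iff_left _ ?_).1 (swap_third_mem hb he hE hG κ hn)
    refine one_one_one_three_mem_of_mem (.inr (.inl (Finset.mem_insert_self _ _))) ?_ hG κ hn
    rw [Finset.card_insert_of_notMem (fun h => hb (Finset.mem_of_mem_erase h)),
      Finset.card_erase_add_one he, hE]
  have outer : ∀ {a b : Fin 5}, mulSq {a} (mulSq {b} (mulSq {a} (mulSq E G))) ∈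
      hitLower 5 n (wcons 1 (wcons 1 (wcons 1 (wcons 3 κ)))) := by
    intro a b
    by_cases hab : a = b
    · subst hab
      exact diag
    · exact (Submodule.add_mem_iff_left _ diag).1 (swap_first_mem hab hE hG κ hn)
  by_cases hm : a ∈ E ∨ b ∈ E ∨ c ∈ E
  · exact one_one_one_three_mem_of_mem hm hE hG κ hn
  simp only [not_or] at hm
  by_cases hbc : b = c
  · subst hbc
    exact diag
  by_cases hac : a = c
  · subst hac
    exact outer
  by_cases hab : a = b
  · subst hab
    exact (Submodule.add_mem_iff_left _ outer).1 (swap_second_mem hbc hE hG κ hn)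
  exfalso
  have h1 : Disjoint E {a, b, c} := by
    simp only [Finset.disjoint_insert_right, Finset.disjoint_singleton_right]
    exact hm
  have h2 := Finset.card_le_univ (E ∪ {a, b, c})
  rw [Finset.card_union_of_disjoint h1, Fintype.card_fin, hE,
    Finset.card_eq_three.2 ⟨a, b, c, hab, hac, hbc, rfl⟩] at h2
  omega

theorem mem_of_card_one_one_one_three {A B C : Finset (Fin 5)} (hA : A.card = 1) (hB : B.card = 1)
    (hC : C.card = 1) (hE : E.card = 3)
    (hn : n = A.card + 2 * (B.card + 2 * (C.card + 2 * (E.card + 2 * m)))) (hG : G ∈ homog 5 m)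
    (κ : ℕ → ℕ) :
    mulSq A (mulSq B (mulSq C (mulSq E G))) ∈
      hitLower 5 n (wcons A.card (wcons B.card (wcons C.card (wcons E.card κ)))) := by
  rw [hA, hB, hC, hE] at hn ⊢
  obtain ⟨a, rfl⟩ := Finset.card_eq_one.1 hA
  obtain ⟨b, rfl⟩ := Finset.card_eq_one.1 hB
  obtain ⟨c, rfl⟩ := Finset.card_eq_one.1 hC
  exact one_one_one_three_mem hE hG κ (by rw [hn]; ring)

end OneOneOneThree

/-! ### Degrees and occurring variables under Steenrod squares -/

/-- Both properties, same variables and degree raised by `i`, are multiplicative in the monomial,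
and for one variable they are read off from x + x²T. -/
theorem totalSq_monomial_coeff_mem {t : ℕ} (u : Fin t →₀ ℕ) (i : ℕ) :
    (totalSq t (MvPolynomial.monomial u 1)).coeff i ∈ span (ZMod 2) {F : Poly t |
      ∃ v : Fin t →₀ ℕ, v.support = u.support ∧ ∑ j, v j = ∑ j, u j + i ∧
        F = MvPolynomial.monomial v 1} := by
  let P : (Fin t →₀ ℕ) → Prop := fun u => ∀ i, (totalSq t (MvPolynomial.monomial u 1)).coeff i ∈
    span (ZMod 2) {F : Poly t | ∃ v : Fin t →₀ ℕ, v.support = u.support ∧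
      ∑ j, v j = ∑ j, u j + i ∧ F = MvPolynomial.monomial v 1}
  have hzero : P 0 := by
    intro i
    rw [MvPolynomial.monomial_zero', MvPolynomial.C_1, map_one, Polynomial.coeff_one]
    split_ifs with h
    · refine subset_span ⟨0, rfl, ?_, ?_⟩
      · simp [h]
      · rw [MvPolynomial.monomial_zero', MvPolynomial.C_1]
    · exact zero_mem _
  have hadd : ∀ u v, P u → P v → P (u + v) := by
    intro u v hu hv i
    rw [show (MvPolynomial.monomial (u + v) 1 : Poly t) =
      MvPolynomial.monomial u 1 * MvPolynomial.monomial v 1 by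
        rw [MvPolynomial.monomial_mul, one_mul], map_mul, Polynomial.coeff_mul]
    refine sum_mem fun p hp => ?_
    rw [Finset.HasAntidiagonal.mem_antidiagonal] at hp
    have h := Submodule.mul_mem_mul (hu p.1) (hv p.2)
    rw [Submodule.span_mul_span] at h
    refine span_mono ?_ h
    rintro _ ⟨_, ⟨u', hu', hu'', rfl⟩, _, ⟨v', hv', hv'', rfl⟩, rfl⟩
    refine ⟨u' + v', ?_, ?_, ?_⟩
    · rw [Finsupp.support_add_eq_union, Finsupp.support_add_eq_union, hu', hv']
    · simp only [Finsupp.add_apply, Finset.sum_add_distrib]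
      omega
    · simp only [MvPolynomial.monomial_mul, one_mul]
  have hone : ∀ j, P (Finsupp.single j 1) := by
    intro j i
    have hs : ∀ k : ℕ, ∑ l, Finsupp.single j k l = k := fun k => by
      simp [Finsupp.single_apply]
    have hX : totalSq t (MvPolynomial.monomial (Finsupp.single j 1) 1) =
        Polynomial.C (MvPolynomial.monomial (Finsupp.single j 1) 1) +
          Polynomial.X * Polynomial.C (MvPolynomial.monomial (Finsupp.single j 2) 1) := by
      rw [← MvPolynomial.X_pow_eq_monomial, ← MvPolynomial.X_pow_eq_monomial, pow_one, totalSq,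
        MvPolynomial.aeval_X]
    rw [hX, Polynomial.coeff_add, Polynomial.coeff_C, mul_comm, Polynomial.coeff_C_mul,
      Polynomial.coeff_X]
    refine add_mem ?_ ?_
    · split_ifs with h
      · exact subset_span ⟨_, rfl, by rw [h, add_zero], rfl⟩
      · exact zero_mem _
    · split_ifs with h
      · rw [mul_one]
        refine subset_span ⟨_, ?_, ?_, rfl⟩
        · rw [Finsupp.support_single _ two_ne_zero,
            Finsupp.support_single _ one_ne_zero]
        · rw [hs, hs, ← h]
      · rw [mul_zero]
        exact zero_mem _
  suffices h : P u from h i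
  induction u using Finsupp.induction_linear with
  | zero => exact hzero
  | add u v hu hv => exact hadd u v hu hv
  | single j a =>
    induction a with
    | zero => rw [Finsupp.single_zero]; exact hzero
    | succ a ih => rw [Finsupp.single_add]; exact hadd _ _ ih (hone j)

theorem mem_homog_iff_mem_span {t m : ℕ} {F : Poly t} : F ∈ homog t m ↔ F ∈ span (ZMod 2)
    {G : Poly t | ∃ u : Fin t →₀ ℕ, ∑ j, u j = m ∧ G = MvPolynomial.monomial u 1} := by
  constructor
  · intro hF
    rw [F.as_sum]
    refine sum_mem fun u hu => ?_
    rw [show (MvPolynomial.monomial u (F.coeff u) : Poly t) =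
      F.coeff u • MvPolynomial.monomial u 1 by
        rw [MvPolynomial.smul_monomial, smul_eq_mul, mul_one]]
    refine smul_mem _ _ (subset_span ⟨u, ?_, rfl⟩)
    rw [← Finsupp.degree_eq_sum]
    by_contra hne
    exact MvPolynomial.mem_support_iff.1 hu (hF.coeff_eq_zero hne)
  · intro hF
    refine span_le.2 ?_ hF
    rintro _ ⟨u, hu, rfl⟩
    exact MvPolynomial.isHomogeneous_monomial _ (by rw [Finsupp.degree_eq_sum, hu])

theorem Sq_homog {t m : ℕ} (i : ℕ) {F : Poly t} (hF : F ∈ homog t m) :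
    Sq t i F ∈ homog t (m + i) := by
  rw [mem_homog_iff_mem_span] at hF
  induction hF using span_induction with
  | zero => rw [map_zero]; exact zero_mem _
  | add x y _ _ hx hy => rw [map_add]; exact add_mem hx hy
  | smul a x _ hx => rw [map_smul]; exact smul_mem _ _ hx
  | mem x hx =>
    obtain ⟨u, hu, rfl⟩ := hx
    rw [mem_homog_iff_mem_span]
    refine span_mono ?_ (totalSq_monomial_coeff_mem u i)
    rintro _ ⟨v, -, hv, rfl⟩
    exact ⟨v, by rw [hv, hu], rfl⟩

theorem hit_le_homog (t n : ℕ) : hit t n ≤ homog t n := by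
  refine span_le.2 ?_
  rintro _ ⟨i, m, rfl, F, hF, rfl⟩
  exact Sq_homog _ hF

/-- The projection onto the span of the monomials in which every variable occurs. -/
def posPart (t : ℕ) : Poly t →ₗ[ZMod 2] Poly t :=
  (MvPolynomial.basisMonomials (Fin t) (ZMod 2)).constr (ZMod 2) fun u =>
    if 0 < ∏ j, u j then MvPolynomial.monomial u 1 else 0

theorem posPart_monomial {t : ℕ} (u : Fin t →₀ ℕ) :
    posPart t (MvPolynomial.monomial u 1) =
      if 0 < ∏ j, u j then MvPolynomial.monomial u 1 else 0 := by
  have h := (MvPolynomial.basisMonomials (Fin t) (ZMod 2)).constr_basis (ZMod 2) (fun u =>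
    if 0 < ∏ j, u j then (MvPolynomial.monomial u 1 : Poly t) else 0) u
  simpa [posPart] using h

theorem prod_pos_iff_support {t : ℕ} (u : Fin t →₀ ℕ) :
    0 < ∏ j, u j ↔ u.support = Finset.univ := by
  rw [Nat.pos_iff_ne_zero, Finset.prod_ne_zero_iff, Finset.eq_univ_iff_forall]
  simp only [Finset.mem_univ, true_implies, Finsupp.mem_support_iff]

theorem posPart_Sq {t : ℕ} (i : ℕ) (F : Poly t) : posPart t (Sq t i F) = Sq t i (posPart t F) := by
  refine span_induction (p := fun F _ => posPart t (Sq t i F) = Sq t i (posPart t F)) ?_ ?_ ?_ ?_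
    (mem_span_monomials F)
  · rintro _ ⟨u, rfl⟩
    have h : ∀ G ∈ span (ZMod 2) {F : Poly t | ∃ v : Fin t →₀ ℕ, v.support = u.support ∧
        ∑ j, v j = ∑ j, u j + i ∧ F = MvPolynomial.monomial v 1},
        posPart t G = if 0 < ∏ j, u j then G else 0 := by
      intro G hG
      induction hG using span_induction with
      | zero => rw [map_zero, ite_self]
      | add x y _ _ hx hy => rw [map_add, hx, hy]; split_ifs <;> simp
      | smul a x _ hx => rw [map_smul, hx]; split_ifs <;> simp
      | mem x hx =>
        obtain ⟨v, hv, -, rfl⟩ := hx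
        rw [posPart_monomial]
        simp only [prod_pos_iff_support, hv]
    rw [Sq_apply, h _ (totalSq_monomial_coeff_mem u i), posPart_monomial]
    split_ifs
    · rfl
    · rw [map_zero]
  · rw [map_zero, map_zero, map_zero]
  · intro x y _ _ hx hy
    rw [map_add, map_add, map_add, map_add, hx, hy]
  · intro a x _ hx
    rw [map_smul, map_smul, map_smul, map_smul, hx]

/-- A subspace spanned by monomials is stable under `posPart`. -/
theorem posPart_mem_span {t : ℕ} {p : (Fin t →₀ ℕ) → Prop} {F : Poly t}
    (hF : F ∈ span (ZMod 2) {G : Poly t | ∃ u, p u ∧ G = MvPolynomial.monomial u 1}) :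
    posPart t F ∈ span (ZMod 2) {G : Poly t | ∃ u, p u ∧ G = MvPolynomial.monomial u 1} := by
  induction hF using span_induction with
  | zero => rw [map_zero]; exact zero_mem _
  | add x y _ _ hx hy => rw [map_add]; exact add_mem hx hy
  | smul a x _ hx => rw [map_smul]; exact smul_mem _ _ hx
  | mem x hx =>
    obtain ⟨u, hu, rfl⟩ := hx
    rw [posPart_monomial]
    split_ifs
    · exact subset_span ⟨u, hu, rfl⟩
    · exact zero_mem _

theorem posPart_homog {t m : ℕ} {F : Poly t} (hF : F ∈ homog t m) : posPart t F ∈ homog t m := by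
  rw [mem_homog_iff_mem_span] at hF ⊢
  exact posPart_mem_span hF

theorem posPart_hit {t n : ℕ} {F : Poly t} (hF : F ∈ hit t n) : posPart t F ∈ hit t n := by
  induction hF using span_induction with
  | zero => rw [map_zero]; exact zero_mem _
  | add x y _ _ hx hy => rw [map_add]; exact add_mem hx hy
  | smul a x _ hx => rw [map_smul]; exact smul_mem _ _ hx
  | mem x hx =>
    obtain ⟨i, m, him, F, hF, rfl⟩ := hx
    rw [posPart_Sq]
    exact subset_span ⟨i, m, him, _, posPart_homog hF, rfl⟩

theorem posPart_mem_polyPos {t : ℕ} (F : Poly t) : posPart t F ∈ polyPos t := by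
  refine span_induction (p := fun F _ => posPart t F ∈ polyPos t) ?_ ?_ ?_ ?_
    (mem_span_monomials F)
  · rintro _ ⟨u, rfl⟩
    rw [posPart_monomial]
    split_ifs with h
    · exact subset_span ⟨u, h, rfl⟩
    · exact zero_mem _
  · rw [map_zero]; exact zero_mem _
  · intro x y _ _ hx hy; rw [map_add]; exact add_mem hx hy
  · intro a x _ hx; rw [map_smul]; exact smul_mem _ _ hx

theorem posPart_eq_self {t : ℕ} {F : Poly t} (hF : F ∈ polyPos t) : posPart t F = F := by
  induction hF using span_induction with
  | zero => rw [map_zero]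
  | add x y _ _ hx hy => rw [map_add, hx, hy]
  | smul a x _ hx => rw [map_smul, hx]
  | mem x hx =>
    obtain ⟨u, hu, rfl⟩ := hx
    rw [posPart_monomial, if_pos hu]

theorem posPart_eq_zero {t : ℕ} {F : Poly t} (hF : F ∈ polyZero t) : posPart t F = 0 := by
  induction hF using span_induction with
  | zero => rw [map_zero]
  | add x y _ _ hx hy => rw [map_add, hx, hy, add_zero]
  | smul a x _ hx => rw [map_smul, hx, smul_zero]
  | mem x hx =>
    obtain ⟨u, hu, rfl⟩ := hx
    rw [posPart_monomial, if_neg (by rw [hu]; exact lt_irrefl 0)]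

theorem sub_posPart_mem_polyZero {t : ℕ} (F : Poly t) : F - posPart t F ∈ polyZero t := by
  refine span_induction (p := fun F _ => F - posPart t F ∈ polyZero t) ?_ ?_ ?_ ?_
    (mem_span_monomials F)
  · rintro _ ⟨u, rfl⟩
    rw [posPart_monomial]
    split_ifs with h
    · rw [sub_self]; exact zero_mem _
    · rw [sub_zero]; exact subset_span ⟨u, by omega, rfl⟩
  · rw [map_zero, sub_zero]; exact zero_mem _
  · intro x y _ _ hx hy; rw [map_add, add_sub_add_comm]; exact add_mem hx hy
  · intro a x _ hx; rw [map_smul, ← smul_sub]; exact smul_mem _ _ hx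

/-! ### Binary levels of exponents and the possible weights in degree 31 -/

theorem exists_eq_consExp {t : ℕ} (u : Fin t →₀ ℕ) :
    ∃ (S : Finset (Fin t)) (v : Fin t →₀ ℕ), u = consExp S v ∧
      ∑ j, u j = S.card + 2 * ∑ j, v j := by
  have h : u = consExp (Finset.univ.filter fun j => u j % 2 = 1) (u.mapRange (· / 2) rfl) := by
    ext j
    rw [consExp_apply, Finsupp.mapRange_apply]
    simp only [Finset.mem_filter, Finset.mem_univ, true_and]
    split_ifs <;> omega
  refine ⟨_, _, h, ?_⟩
  conv_lhs => rw [h]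
  simp only [consExp_apply, Finset.sum_add_distrib, ← Finset.mul_sum]
  simp

theorem weight_zero_apply {t : ℕ} (k : ℕ) : weight (0 : Fin t →₀ ℕ) k = 0 := by
  simp [weight_apply]

/-- Parity fixes each entry modulo 2 once the earlier ones are known, which leaves a short tree. The
alternatives are the patterns excluded above, each at the depths where it is needed. -/
theorem weight_cases {a b c d e : ℕ} (ha : a ≤ 5) (hb : b ≤ 5) (hc : c ≤ 5)
    (hdeg : a + 2 * (b + 2 * (c + 2 * (d + 2 * (e + 2 * 0)))) = 31) (ha5 : a ≠ 5)
    (h₁ : ¬(a = 1 ∧ b = 1 ∧ c = 1 ∧ d = 1 ∧ e = 1))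
    (h₂ : ¬(a = 3 ∧ b = 2 ∧ c = 2 ∧ d = 2 ∧ e = 0))
    (h₃ : ¬(a = 3 ∧ b = 4 ∧ c = 3 ∧ d = 1 ∧ e = 0)) :
    (b = 0 ∧ 0 < c) ∨ (c = 0 ∧ 0 < d) ∨ (d = 0 ∧ 0 < e) ∨ (a < 5 ∧ b = 5) ∨ (b < 5 ∧ c = 5) ∨
      (c = 1 ∧ d = 2) ∨ (a = 1 ∧ b = 3 ∧ 2 ≤ c) ∨ (b = 1 ∧ c = 3 ∧ 2 ≤ d) ∨
      (a = 1 ∧ b = 1 ∧ c = 1 ∧ d = 3) ∨ (a = 3 ∧ b = 2 ∧ c = 4) := by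
  by_contra! h
  obtain ⟨g1, g2, g3, g4, g5, g6, g7, g8, g9, g10⟩ := h
  obtain rfl | rfl : a = 1 ∨ a = 3 := by clear * - ha5 hdeg ha; omega
  · obtain rfl | rfl : b = 1 ∨ b = 3 := by
      clear * - hb hdeg g4
      omega
    · obtain rfl | rfl : c = 1 ∨ c = 3 := by
        clear * - hc hdeg g5
        omega
      · have := g9 rfl rfl rfl
        clear * - this h₁ hdeg
        omega
      · have := g8 rfl rfl
        clear * - this g3 hdeg
        omega
    · have := g7 rfl rfl
      clear * - this g2 hdeg
      omega
  · obtain rfl | rfl : b = 2 ∨ b = 4 := by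
      clear * - hb hdeg g1
      omega
    · have := g10 rfl rfl
      obtain rfl : c = 2 := by
        clear * - this g2 hdeg hc
        omega
      clear * - h₂ g3 hdeg
      omega
    · obtain rfl | rfl : c = 1 ∨ c = 3 := by
        clear * - hc hdeg g5
        omega
      · have := g6 rfl
        clear * - this g3 hdeg
        omega
      · clear * - h₃ hdeg
        omega

theorem mulSq_mem_of_weights {A B C D E : Finset (Fin 5)}
    (hdeg : A.card + 2 * (B.card + 2 * (C.card + 2 * (D.card + 2 * (E.card + 2 * 0)))) = 31)
    (hA : A.card ≠ 5) {G : Poly 5} (hG : G ∈ homog 5 0) (κ : ℕ → ℕ)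
    (h₁ : ¬(A.card = 1 ∧ B.card = 1 ∧ C.card = 1 ∧ D.card = 1 ∧ E.card = 1))
    (h₂ : ¬(A.card = 3 ∧ B.card = 2 ∧ C.card = 2 ∧ D.card = 2 ∧ E.card = 0))
    (h₃ : ¬(A.card = 3 ∧ B.card = 4 ∧ C.card = 3 ∧ D.card = 1 ∧ E.card = 0)) :
    mulSq A (mulSq B (mulSq C (mulSq D (mulSq E G)))) ∈ hitLower 5 31
      (wcons A.card (wcons B.card (wcons C.card (wcons D.card (wcons E.card κ))))) := by
  have key : (B.card = 0 ∧ 0 < C.card) ∨ (C.card = 0 ∧ 0 < D.card) ∨ (D.card = 0 ∧ 0 < E.card) ∨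
      (A.card < 5 ∧ B.card = 5) ∨ (B.card < 5 ∧ C.card = 5) ∨ (C.card = 1 ∧ D.card = 2) ∨
      (A.card = 1 ∧ B.card = 3 ∧ 2 ≤ C.card) ∨ (B.card = 1 ∧ C.card = 3 ∧ 2 ≤ D.card) ∨
      (A.card = 1 ∧ B.card = 1 ∧ C.card = 1 ∧ D.card = 3) ∨
      (A.card = 3 ∧ B.card = 2 ∧ C.card = 4) := by
    have hcard (S : Finset (Fin 5)) : S.card ≤ 5 := by simpa using Finset.card_le_univ S
    exact weight_cases (hcard A) (hcard B) (hcard C) hdeg hA h₁ h₂ h₃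
  have hE := mulSq_homog E hG
  have hD := mulSq_homog D hE
  have hC := mulSq_homog C hD
  have lift₁ := fun {F : Poly 5} {n : ℕ} {κ : ℕ → ℕ} (h : F ∈ hitLower 5 n κ) =>
    mulSq_hitLower A h
  have lift₂ := fun {F : Poly 5} {n : ℕ} {κ : ℕ → ℕ} (h : F ∈ hitLower 5 n κ) =>
    mulSq_hitLower A (mulSq_hitLower B h)
  have lift₃ := fun {F : Poly 5} {n : ℕ} {κ : ℕ → ℕ} (h : F ∈ hitLower 5 n κ) =>
    mulSq_hitLower A (mulSq_hitLower B (mulSq_hitLower C h))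
  rw [← hdeg]
  rcases key with ⟨h, h'⟩ | ⟨h, h'⟩ | ⟨h, h'⟩ | ⟨h, h'⟩ | ⟨h, h'⟩ | ⟨h, h'⟩ | ⟨h, h', h''⟩ |
    ⟨h, h', h''⟩ | ⟨h, h', h'', h'''⟩ | ⟨h, h', h''⟩
  · exact lift₁ (mem_of_card_zero h h' rfl hD _)
  · exact lift₂ (mem_of_card_zero h h' rfl hE _)
  · exact lift₃ (mem_of_card_zero h h' rfl hG _)
  · exact mem_of_card_lt_five h h' rfl hC _
  · exact lift₁ (mem_of_card_lt_five h h' rfl hD _)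
  · exact lift₂ (mem_of_card_one_two h h' rfl hE _)
  · exact mem_of_card_one_three h h' h'' rfl hD _
  · exact lift₁ (mem_of_card_one_three h h' h'' rfl hE _)
  · exact mem_of_card_one_one_one_three h h' h'' h''' rfl hE _
  · exact mem_of_card_three_two_four h h' h'' rfl hD _

theorem eq_toFinsupp_of_wcons {w : ℕ →₀ ℕ} {a b c d e : ℕ} {κ : ℕ → ℕ}
    (h : ⇑w = wcons a (wcons b (wcons c (wcons d (wcons e κ))))) (hκ : ∀ k, κ k = 0) :
    w = [a, b, c, d, e].toFinsupp := by
  ext k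
  rw [h, List.toFinsupp_apply]
  match k with
  | 0 | 1 | 2 | 3 | 4 => rfl
  | k + 5 => simpa [wcons] using hκ k

theorem toFinsupp_append_zero (L : List ℕ) : (L ++ [0]).toFinsupp = L.toFinsupp := by
  ext k
  rw [List.toFinsupp_apply, List.toFinsupp_apply]
  simp only [List.getD_eq_getElem?_getD, List.getElem?_append]
  split_ifs with h
  · rfl
  · rw [List.getElem?_eq_none (not_lt.1 h)]
    rcases k - L.length with _ | i <;> simp

theorem monomial_mem_hitLower {u : Fin 5 →₀ ℕ} (hu : ∑ j, u j = 31) (hu5 : weight u 0 ≠ 5)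
    (h₁ : weight u ≠ [1, 1, 1, 1, 1].toFinsupp) (h₂ : weight u ≠ [3, 2, 2, 2].toFinsupp)
    (h₃ : weight u ≠ [3, 4, 3, 1].toFinsupp) :
    (MvPolynomial.monomial u 1 : Poly 5) ∈ hitLower 5 31 (weight u) := by
  obtain ⟨A, u, rfl, hA⟩ := exists_eq_consExp u
  obtain ⟨B, u, rfl, hB⟩ := exists_eq_consExp u
  obtain ⟨C, u, rfl, hC⟩ := exists_eq_consExp u
  obtain ⟨D, u, rfl, hD⟩ := exists_eq_consExp u
  obtain ⟨E, u, rfl, hE⟩ := exists_eq_consExp u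
  -- Five levels exhaust the exponents: what remains enters the degree with the factor 32 > 31.
  have h0 : ∑ j, u j = 0 := by omega
  obtain rfl : u = 0 := by
    ext j
    exact Finset.sum_eq_zero_iff.1 h0 j (Finset.mem_univ j)
  have hw : ⇑(weight (consExp A (consExp B (consExp C (consExp D (consExp E 0)))))) =
      wcons A.card (wcons B.card (wcons C.card (wcons D.card (wcons E.card
        (weight (0 : Fin 5 →₀ ℕ)))))) := by
    simp only [weight_consExp]
  have hlist := eq_toFinsupp_of_wcons hw weight_zero_apply
  rw [hw]
  simp only [← mulSq_monomial]
  refine mulSq_mem_of_weights (by omega) ?_ ?_ _ ?_ ?_ ?_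
  · rw [hw] at hu5
    exact hu5
  · exact MvPolynomial.isHomogeneous_monomial _ rfl
  · rintro ⟨hA, hB, hC, hD, hE⟩
    rw [hA, hB, hC, hD, hE] at hlist
    exact h₁ hlist
  · rintro ⟨hA, hB, hC, hD, hE⟩
    rw [hA, hB, hC, hD, hE] at hlist
    exact h₂ (hlist.trans (toFinsupp_append_zero [3, 2, 2, 2]))
  · rintro ⟨hA, hB, hC, hD, hE⟩
    rw [hA, hB, hC, hD, hE] at hlist
    exact h₃ (hlist.trans (toFinsupp_append_zero [3, 4, 3, 1]))

/-! ### Degrees of weight vectors -/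

theorem weightDeg_toFinsupp (L : List ℕ) :
    weightDeg L.toFinsupp = ∑ k ∈ Finset.range L.length, 2 ^ k * L.getD k 0 := by
  rw [weightDeg, Finsupp.sum_of_support_subset _ (s := Finset.range L.length) _ _
    (fun _ _ => mul_zero _)]
  · rfl
  · intro k hk
    rw [Finsupp.mem_support_iff, List.toFinsupp_apply] at hk
    rw [Finset.mem_range]
    by_contra h
    exact hk (List.getD_eq_default _ _ (not_lt.1 h))

/-! ### Homogeneous parts of `hitLower` -/

theorem homogeneousComponent_mem_span {t : ℕ} (n : ℕ) {p : (Fin t →₀ ℕ) → Prop} {F : Poly t}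
    (hF : F ∈ span (ZMod 2) {G : Poly t | ∃ u, p u ∧ G = MvPolynomial.monomial u 1}) :
    MvPolynomial.homogeneousComponent n F ∈ span (ZMod 2)
      {G : Poly t | ∃ u, (∑ j, u j = n ∧ p u) ∧ G = MvPolynomial.monomial u 1} := by
  induction hF using span_induction with
  | zero => rw [map_zero]; exact zero_mem _
  | add x y _ _ hx hy => rw [map_add]; exact add_mem hx hy
  | smul a x _ hx => rw [map_smul]; exact smul_mem _ _ hx
  | mem x hx =>
    obtain ⟨u, hu, rfl⟩ := hx
    rw [MvPolynomial.homogeneousComponent_of_mem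
      ((MvPolynomial.mem_homogeneousSubmodule _ _).2 (MvPolynomial.isHomogeneous_monomial _ rfl))]
    split_ifs with h
    · exact subset_span ⟨u, ⟨by rw [h, Finsupp.degree_eq_sum], hu⟩, rfl⟩
    · exact zero_mem _

/-- `lower` mixes all degrees; taking the component of degree `n` restricts it to monomials of that
degree. -/
theorem mem_of_mem_hitLower {t n : ℕ} {κ : ℕ → ℕ} {N : Submodule (ZMod 2) (Poly t)} {F : Poly t}
    (hF : F ∈ homog t n) (h : F ∈ hitLower t n κ) (hN : hit t n ≤ N)
    (hm : ∀ u : Fin t →₀ ℕ, ∑ j, u j = n → wlt (weight u) κ → MvPolynomial.monomial u 1 ∈ N) :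
    F ∈ N := by
  obtain ⟨H, hH, L, hL, rfl⟩ := mem_sup.1 h
  refine add_mem (hN hH) ?_
  have hL' : L ∈ homog t n := (Submodule.add_mem_iff_right _ (hit_le_homog t n hH)).1 hF
  have h1 := homogeneousComponent_mem_span n hL
  rw [MvPolynomial.homogeneousComponent_of_mem hL', if_pos rfl] at h1
  refine span_le.2 ?_ h1
  rintro _ ⟨u, ⟨hu, hu'⟩, rfl⟩
  exact hm u hu hu'

theorem monomial_homog {t n : ℕ} {u : Fin t →₀ ℕ} (hu : ∑ j, u j = n) :
    (MvPolynomial.monomial u 1 : Poly t) ∈ homog t n :=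
  mem_homog_iff_mem_span.2 (subset_span ⟨u, hu, rfl⟩)

/-- If every monomial of weight below `κ` lies in `N` or is hit modulo monomials of lower weight,
then all these monomials lie in `N`. -/
theorem monomial_mem_of_forall {t n : ℕ} {κ : ℕ → ℕ} {N : Submodule (ZMod 2) (Poly t)}
    (hN : hit t n ≤ N)
    (h : ∀ u : Fin t →₀ ℕ, ∑ j, u j = n → wlt (weight u) κ →
      (MvPolynomial.monomial u 1 : Poly t) ∈ N ∨
        (MvPolynomial.monomial u 1 : Poly t) ∈ hitLower t n (weight u)) :
    ∀ u : Fin t →₀ ℕ, ∑ j, u j = n → wlt (weight u) κ →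
      (MvPolynomial.monomial u 1 : Poly t) ∈ N := by
  have hfin : Finite {u : Fin t →₀ ℕ // ∑ j, u j = n} := by
    refine Set.Finite.subset (Finsupp.finite_of_degree_eq (σ := Fin t) n) fun u hu => ?_
    rw [Set.mem_ofPred_eq, Finsupp.degree_eq_sum]
    exact hu
  -- The left lexicographic order is not well-founded on all finitely supported sequences;
  -- finiteness of the set of monomials of degree `n` is essential.
  have hwf : WellFounded fun u v : {u : Fin t →₀ ℕ // ∑ j, u j = n} =>
      toLex (weight u.1) < toLex (weight v.1) := by
    have : IsTrans {u : Fin t →₀ ℕ // ∑ j, u j = n}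
        fun u v => toLex (weight u.1) < toLex (weight v.1) := ⟨fun _ _ _ => lt_trans⟩
    have : Std.Irrefl fun u v : {u : Fin t →₀ ℕ // ∑ j, u j = n} =>
        toLex (weight u.1) < toLex (weight v.1) := ⟨fun _ => lt_irrefl _⟩
    exact Finite.wellFounded_of_trans_of_irrefl _
  suffices H : ∀ u : {u : Fin t →₀ ℕ // ∑ j, u j = n}, wlt (weight u.1) κ →
      (MvPolynomial.monomial u.1 1 : Poly t) ∈ N from fun u hu hκ => H ⟨u, hu⟩ hκ
  intro u
  induction u using hwf.induction with
  | _ u ih =>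
    intro hκ
    rcases h u.1 u.2 hκ with h | h
    · exact h
    · exact mem_of_mem_hitLower (monomial_homog u.2) h hN
        fun v hv hvu => ih ⟨v, hv⟩ hvu (wlt_trans hvu hκ)

/-! ### Subspaces of `Q` -/

theorem polyLE_le_homog (t n : ℕ) (η : ℕ →₀ ℕ) : polyLE t n η ≤ homog t n := by
  refine span_le.2 ?_
  rintro _ ⟨u, hu, -, -, rfl⟩
  exact monomial_homog hu

theorem polyLT_le_polyLE (t n : ℕ) (η : ℕ →₀ ℕ) : polyLT t n η ≤ polyLE t n η := by
  refine span_mono ?_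
  rintro _ ⟨u, hu, hη, h, rfl⟩
  exact ⟨u, hu, hη, h.le, rfl⟩

theorem posPart_polyLE {t n : ℕ} {η : ℕ →₀ ℕ} {F : Poly t} (hF : F ∈ polyLE t n η) :
    posPart t F ∈ polyLE t n η := by
  have h := posPart_mem_span (p := fun u => ∑ j, u j = n ∧ weightDeg η = n ∧
    toLex (weight u) ≤ toLex η) (F := F) (by simpa only [polyLE, and_assoc] using hF)
  simpa only [polyLE, and_assoc] using h

theorem posPart_polyLT {t n : ℕ} {η : ℕ →₀ ℕ} {F : Poly t} (hF : F ∈ polyLT t n η) :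
    posPart t F ∈ polyLT t n η := by
  have h := posPart_mem_span (p := fun u => ∑ j, u j = n ∧ weightDeg η = n ∧
    toLex (weight u) < toLex η) (F := F) (by simpa only [polyLT, and_assoc] using hF)
  simpa only [polyLT, and_assoc] using h

/-- The projection `P_n → Q_n`. -/
abbrev toQ (t n : ℕ) : homog t n →ₗ[ZMod 2] Q t n := ((hit t n).submoduleOf (homog t n)).mkQ

theorem toQ_mem_imageInQ {t n : ℕ} {V : Submodule (ZMod 2) (Poly t)} {x : homog t n} :
    toQ t n x ∈ imageInQ t n V ↔ (x : Poly t) ∈ hit t n ⊔ (V ⊓ homog t n) := by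
  rw [imageInQ, ← Submodule.mem_comap, Submodule.comap_map_mkQ, mem_sup, mem_sup]
  constructor
  · rintro ⟨y, hy, z, hz, rfl⟩
    exact ⟨y, hy, z, ⟨hz, z.2⟩, rfl⟩
  · rintro ⟨y, hy, z, ⟨hz, hz'⟩, h⟩
    exact ⟨⟨y, hit_le_homog t n hy⟩, hy, ⟨z, hz'⟩, hz, Subtype.ext h⟩

theorem imageInQ_mono {t n : ℕ} {V W : Submodule (ZMod 2) (Poly t)}
    (h : V ⊓ homog t n ≤ hit t n ⊔ (W ⊓ homog t n)) : imageInQ t n V ≤ imageInQ t n W := by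
  intro q hq
  obtain ⟨x, rfl⟩ := Submodule.mkQ_surjective _ q
  rw [toQ_mem_imageInQ] at hq ⊢
  exact sup_le le_sup_left h hq

theorem imageInQ_sup {t n : ℕ} {V W : Submodule (ZMod 2) (Poly t)} :
    imageInQ t n V ⊔ imageInQ t n W = imageInQ t n ((V ⊓ homog t n) ⊔ (W ⊓ homog t n)) := by
  refine le_antisymm (sup_le (imageInQ_mono ?_) (imageInQ_mono ?_)) ?_
  · exact (le_inf (le_sup_left (a := V ⊓ homog t n)) inf_le_right).trans le_sup_right
  · exact (le_inf (le_sup_right (b := W ⊓ homog t n)) inf_le_right).trans le_sup_right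
  · rintro q ⟨x, hx, rfl⟩
    obtain ⟨y, ⟨hy, hy'⟩, z, ⟨hz, hz'⟩, h⟩ := mem_sup.1 hx
    have hx : x = ⟨y, hy'⟩ + ⟨z, hz'⟩ := Subtype.ext h.symm
    rw [hx, map_add]
    exact add_mem_sup (Submodule.mem_map_of_mem hy) (Submodule.mem_map_of_mem hz)

/-- Apply `posPart` to a decomposition F = hit + w: it fixes F and preserves both summands' spaces.
-/
theorem imageInQ_inf_polyPos_mono {t n : ℕ} {V W : Submodule (ZMod 2) (Poly t)}
    (hW : W ≤ homog t n) (hpos : ∀ F ∈ W, posPart t F ∈ W) (h : V ≤ hit t n ⊔ W) :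
    imageInQ t n (V ⊓ polyPos t) ≤ imageInQ t n (W ⊓ polyPos t) := by
  refine imageInQ_mono fun F hF => ?_
  obtain ⟨y, hy, z, hz, hF'⟩ := mem_sup.1 (h hF.1.1)
  rw [← posPart_eq_self hF.1.2, ← hF', map_add]
  exact add_mem_sup (posPart_hit hy) ⟨⟨hpos z hz, posPart_mem_polyPos z⟩, hW (hpos z hz)⟩

instance finite_homog (t n : ℕ) : Module.Finite (ZMod 2) (homog t n) :=
  Module.Finite.iff_fg.2 (MvPolynomial.homogeneousSubmodule_fg _ _ n)

instance finite_Q (t n : ℕ) : Module.Finite (ZMod 2) (Q t n) :=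
  Module.Finite.quotient _ _

instance finite_polyLE (t n : ℕ) (η : ℕ →₀ ℕ) : Module.Finite (ZMod 2) (polyLE t n η) :=
  Submodule.finiteDimensional_of_le (polyLE_le_homog t n η)

instance finite_QWeight (t n : ℕ) (η : ℕ →₀ ℕ) : Module.Finite (ZMod 2) (QWeight t n η) :=
  Module.Finite.quotient _ _

/-- The filtration of `Q_n` by weights, relative to `Q_n⁰`: the step at `η` adds the dimension of
the positive part of `Q_n^η`. -/
theorem finrank_sup_imageInQ (t n : ℕ) (η : ℕ →₀ ℕ) :
    Module.finrank (ZMod 2) ↥(QZero t n ⊔ imageInQ t n (polyLE t n η ⊓ polyPos t)) =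
      Module.finrank (ZMod 2) ↥(QZero t n ⊔ imageInQ t n (polyLT t n η ⊓ polyPos t)) +
        Module.finrank (ZMod 2) (QWeightPos t n η) := by
  set V := polyLE t n η ⊓ polyPos t with hV
  set G := QZero t n ⊔ imageInQ t n (polyLT t n η ⊓ polyPos t) with hG
  have hVh : V ≤ homog t n := inf_le_left.trans (polyLE_le_homog t n η)
  let γ : V →ₗ[ZMod 2] Q t n := toQ t n ∘ₗ Submodule.inclusion hVh
  let β : V →ₗ[ZMod 2] QWeight t n η :=
    ((hit t n ⊓ polyLE t n η ⊔ polyLT t n η).submoduleOf (polyLE t n η)).mkQ ∘ₗ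
      Submodule.inclusion inf_le_left
  have hγ : LinearMap.range γ = imageInQ t n V := by
    ext q
    constructor
    · rintro ⟨x, rfl⟩
      exact ⟨Submodule.inclusion hVh x, x.2, rfl⟩
    · rintro ⟨x, hx, rfl⟩
      exact ⟨⟨x, hx⟩, rfl⟩
  have hβ : LinearMap.range β = QWeightPos t n η := by
    ext q
    constructor
    · rintro ⟨x, rfl⟩
      exact ⟨Submodule.inclusion inf_le_left x, x.2.2, rfl⟩
    · rintro ⟨x, hx, rfl⟩
      exact ⟨⟨x, x.2, hx⟩, rfl⟩
  -- The core of the argument: V maps to the filtration quotient and to Q^η with the same kernel.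
  -- `posPart` removes the contribution of Q⁰ in one direction and makes the lower-weight term
  -- positive in the other.
  have hker : LinearMap.ker (G.mkQ ∘ₗ γ) = LinearMap.ker β := by
    ext x
    rw [LinearMap.mem_ker, LinearMap.mem_ker, LinearMap.comp_apply, LinearMap.comp_apply,
      Submodule.mkQ_apply, Submodule.Quotient.mk_eq_zero]
    refine Iff.trans ?_ (Submodule.Quotient.mk_eq_zero _).symm
    change toQ t n (Submodule.inclusion hVh x) ∈ G ↔
      (x : Poly t) ∈ hit t n ⊓ polyLE t n η ⊔ polyLT t n η
    rw [hG, QZero, imageInQ_sup, toQ_mem_imageInQ]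
    have hx := posPart_eq_self x.2.2
    constructor
    · intro h
      obtain ⟨y, hy, z, ⟨hz, -⟩, h⟩ := mem_sup.1 h
      obtain ⟨z₀, hz₀, z₁, hz₁, rfl⟩ := mem_sup.1 hz
      have e : (x : Poly t) = posPart t y + z₁ := by
        rw [← hx, show (x : Poly t) = y + (z₀ + z₁) from h.symm, map_add, map_add,
          posPart_eq_zero hz₀.1, posPart_eq_self hz₁.1.2, zero_add]
      have hy' : posPart t y ∈ polyLE t n η := by
        rw [eq_sub_iff_add_eq.2 e.symm]
        exact sub_mem x.2.1 (polyLT_le_polyLE t n η hz₁.1.1)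
      rw [e]
      exact add_mem_sup ⟨posPart_hit hy, hy'⟩ hz₁.1.1
    · intro h
      obtain ⟨y, hy, z, hz, h⟩ := mem_sup.1 h
      have hz' : posPart t z ∈ polyLT t n η ⊓ polyPos t :=
        ⟨posPart_polyLT hz, posPart_mem_polyPos z⟩
      have hz'' : posPart t z ∈ homog t n :=
        polyLE_le_homog t n η (polyLT_le_polyLE t n η hz'.1)
      change (x : Poly t) ∈ _
      rw [← hx, ← h, map_add]
      exact add_mem_sup (posPart_hit hy.1) ⟨mem_sup_right ⟨hz', hz''⟩, hz''⟩
  have hle : G ≤ QZero t n ⊔ imageInQ t n V :=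
    sup_le_sup_left (Submodule.map_mono (Submodule.comap_mono
      (inf_le_inf_right _ (polyLT_le_polyLE t n η)))) _
  have hsup : QZero t n ⊔ imageInQ t n V = LinearMap.range γ ⊔ G := by
    refine le_antisymm (sup_le (le_sup_left.trans le_sup_right) ?_) (sup_le ?_ hle)
    · rw [← hγ]
      exact le_sup_left
    · rw [hγ]
      exact le_sup_right
  have h1 := LinearMap.finrank_range_add_finrank_ker
    (G.mkQ.domRestrict (QZero t n ⊔ imageInQ t n V))
  have h2 : LinearMap.range (G.mkQ.domRestrict (QZero t n ⊔ imageInQ t n V)) =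
      LinearMap.range (G.mkQ ∘ₗ γ) := by
    rw [LinearMap.range_domRestrict, hsup, Submodule.map_sup, LinearMap.range_comp γ,
      Submodule.mkQ_map_self, sup_bot_eq]
  have h3 : Module.finrank (ZMod 2) (LinearMap.ker
      (G.mkQ.domRestrict (QZero t n ⊔ imageInQ t n V))) = Module.finrank (ZMod 2) G := by
    rw [LinearMap.ker_domRestrict, Submodule.ker_mkQ]
    exact (Submodule.submoduleOfEquivOfLe hle).finrank_eq
  have h4 : Module.finrank (ZMod 2) (LinearMap.range (G.mkQ ∘ₗ γ)) =
      Module.finrank (ZMod 2) (LinearMap.range β) :=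
    ((G.mkQ ∘ₗ γ).quotKerEquivRange.symm.trans
      ((Submodule.quotEquivOfEq _ _ hker).trans β.quotKerEquivRange)).finrank_eq
  rw [← h1, h2, h3, h4, hβ, add_comm]

/-! ### The kernel of Kameko's map -/

theorem kameko_toQ {t m n : ℕ} (h : m = t + 2 * n) (x : homog t m) :
    kameko t h (toQ t m x) = 0 ↔ kamekoPoly t x ∈ hit t n :=
  Submodule.Quotient.mk_eq_zero _

theorem kamekoPoly_mulSq_univ {t : ℕ} (F : Poly t) : kamekoPoly t (mulSq Finset.univ F) = F := by
  rw [mulSq_apply, mul_comm, kamekoPoly_sq_mul, kamekoPoly_prod, if_pos rfl, mul_one]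

theorem kameko_surjective {t m n : ℕ} (h : m = t + 2 * n) : Function.Surjective (kameko t h) := by
  intro q
  obtain ⟨y, rfl⟩ := Submodule.mkQ_surjective _ q
  have hy : mulSq Finset.univ (y : Poly t) ∈ homog t m := by
    have := mulSq_homog Finset.univ y.2
    rwa [Finset.card_univ, Fintype.card_fin, ← h] at this
  refine ⟨toQ t m ⟨_, hy⟩, congrArg (toQ t n) (Subtype.ext ?_)⟩
  exact kamekoPoly_mulSq_univ _

theorem weight_zero_lt {t : ℕ} {u : Fin t →₀ ℕ} (h : ¬∀ j, Odd (u j)) : weight u 0 < t := by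
  push Not at h
  obtain ⟨j, hj⟩ := h
  rw [weight_apply]
  calc ∑ j, u j / 2 ^ 0 % 2 < ∑ _j : Fin t, 1 := by
        refine Finset.sum_lt_sum (fun i _ => by omega) ⟨j, Finset.mem_univ j, ?_⟩
        have := Nat.even_iff.1 (Nat.not_odd_iff_even.1 hj)
        rw [pow_zero, Nat.div_one]
        omega
    _ = t := by simp

theorem kamekoPoly_eq_zero {t : ℕ} {u : Fin t →₀ ℕ} (h : weight u 0 ≠ t) :
    kamekoPoly t (MvPolynomial.monomial u 1) = 0 := by
  rw [kamekoPoly_monomial, if_neg]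
  intro hodd
  refine h ?_
  rw [weight_apply]
  calc ∑ j, u j / 2 ^ 0 % 2 = ∑ _j : Fin t, 1 := by
        refine Finset.sum_congr rfl fun j _ => ?_
        rw [pow_zero, Nat.div_one, Nat.odd_iff.1 (hodd j)]
    _ = t := by simp

theorem sub_mulSq_kamekoPoly_mem {t : ℕ} (F : Poly t) :
    F - mulSq Finset.univ (kamekoPoly t F) ∈ lower t (wcons t 0) := by
  refine span_induction (p := fun F _ => F - mulSq Finset.univ (kamekoPoly t F) ∈
    lower t (wcons t 0)) ?_ ?_ ?_ ?_ (mem_span_monomials F)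
  · rintro _ ⟨u, rfl⟩
    rw [kamekoPoly_monomial]
    split_ifs with h
    · rw [mulSq_monomial, show consExp Finset.univ (u.mapRange (fun a => (a - 1) / 2) rfl) = u from
        Finsupp.ext fun j => ?_, sub_self]
      · exact zero_mem _
      · rw [consExp_apply, if_pos (Finset.mem_univ j), Finsupp.mapRange_apply]
        have := Nat.odd_iff.1 (h j)
        omega
    · rw [map_zero, sub_zero]
      exact subset_span ⟨u, ⟨0, fun i hi => absurd hi (Nat.not_lt_zero i), weight_zero_lt h⟩, rfl⟩
  · rw [map_zero, map_zero, sub_zero]; exact zero_mem _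
  · intro x y _ _ hx hy; rw [map_add, map_add, add_sub_add_comm]; exact add_mem hx hy
  · intro a x _ hx; rw [map_smul, map_smul, ← smul_sub]; exact smul_mem _ _ hx

theorem weight_zero_lt_of_wlt {t : ℕ} {u : Fin t →₀ ℕ} (h : wlt (weight u) (wcons t 0)) :
    weight u 0 < t := by
  obtain ⟨k, hk, hk'⟩ := h
  cases k with
  | zero => exact hk'
  | succ k => exact absurd hk' (Nat.not_lt_zero _)

/-- Modulo monomials with some even exponent, F is x₁⋯x_t times the square of its Kameko image, and
prepending the full level to a hit element stays hit modulo ω₁ < t. The bound `wcons t 0` says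
exactly ω₁ < t, as no sequence lies below 0. -/
theorem mem_hitLower_of_kamekoPoly_mem {t m n : ℕ} (h : m = t + 2 * n) {F : Poly t}
    (hF : kamekoPoly t F ∈ hit t n) : F ∈ hitLower t m (wcons t 0) := by
  have h1 := mulSq_hitLower Finset.univ (mem_sup_left hF : _ ∈ hitLower t n 0)
  rw [Finset.card_univ, Fintype.card_fin, ← h] at h1
  rw [← sub_add_cancel F (mulSq Finset.univ (kamekoPoly t F))]
  exact add_mem (mem_sup_right (sub_mulSq_kamekoPoly_mem F)) h1

/-! ### Degree 31 in five variables -/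

theorem wlt_irrefl {f : ℕ → ℕ} : ¬wlt f f := fun ⟨_, _, h⟩ => lt_irrefl _ h

/-- To reduce the monomials of weight below `η` modulo hit elements it suffices to treat the three
exceptional weights. -/
theorem polyLT_le_hit_sup {η : ℕ →₀ ℕ} {W : Submodule (ZMod 2) (Poly 5)} (hη5 : η 0 < 5)
    (h : ∀ u : Fin 5 →₀ ℕ, ∑ j, u j = 31 → wlt (weight u) η →
      weight u = [1, 1, 1, 1, 1].toFinsupp ∨ weight u = [3, 2, 2, 2].toFinsupp ∨
        weight u = [3, 4, 3, 1].toFinsupp → MvPolynomial.monomial u 1 ∈ W) :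
    polyLT 5 31 η ≤ hit 5 31 ⊔ W := by
  have key := monomial_mem_of_forall (t := 5) (n := 31) (κ := η) (N := hit 5 31 ⊔ W) le_sup_left ?_
  · refine span_le.2 ?_
    rintro _ ⟨u, hu, -, hlt, rfl⟩
    exact key u hu hlt
  · intro u hu hlt
    by_cases hw : weight u = [1, 1, 1, 1, 1].toFinsupp ∨ weight u = [3, 2, 2, 2].toFinsupp ∨
        weight u = [3, 4, 3, 1].toFinsupp
    · exact .inl (mem_sup_right (h u hu hlt hw))
    · simp only [not_or] at hw
      refine .inr (monomial_mem_hitLower hu ?_ hw.1 hw.2.1 hw.2.2)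
      obtain ⟨k, hk, hk'⟩ := hlt
      cases k with
      | zero => omega
      | succ k => rw [hk 0 (Nat.succ_pos k)]; omega

theorem wlt_first_second : wlt [1, 1, 1, 1, 1].toFinsupp [3, 2, 2, 2].toFinsupp :=
  ⟨0, fun i hi => absurd hi (Nat.not_lt_zero i), by simp [List.toFinsupp_apply]⟩

theorem wlt_second_third : wlt [3, 2, 2, 2].toFinsupp [3, 4, 3, 1].toFinsupp := by
  refine ⟨1, fun i hi => ?_, by simp [List.toFinsupp_apply]⟩
  obtain rfl : i = 0 := by omega
  simp [List.toFinsupp_apply]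

theorem weightDeg_first : weightDeg [1, 1, 1, 1, 1].toFinsupp = 31 := by
  rw [weightDeg_toFinsupp]; rfl

theorem weightDeg_second : weightDeg [3, 2, 2, 2].toFinsupp = 31 := by
  rw [weightDeg_toFinsupp]; rfl

theorem weightDeg_third : weightDeg [3, 4, 3, 1].toFinsupp = 31 := by
  rw [weightDeg_toFinsupp]; rfl

theorem polyLT_first_le : polyLT 5 31 [1, 1, 1, 1, 1].toFinsupp ≤ hit 5 31 ⊔ ⊥ := by
  refine polyLT_le_hit_sup (by simp [List.toFinsupp_apply]) fun u _ hlt hw => ?_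
  rcases hw with hw | hw | hw <;> rw [hw] at hlt
  · exact absurd hlt wlt_irrefl
  · exact absurd (wlt_trans hlt wlt_first_second) wlt_irrefl
  · exact absurd (wlt_trans hlt (wlt_trans wlt_first_second wlt_second_third)) wlt_irrefl

theorem polyLT_second_le :
    polyLT 5 31 [3, 2, 2, 2].toFinsupp ≤ hit 5 31 ⊔ polyLE 5 31 [1, 1, 1, 1, 1].toFinsupp := by
  refine polyLT_le_hit_sup (by simp [List.toFinsupp_apply]) fun u hu hlt hw => ?_
  rcases hw with hw | hw | hw
  · exact subset_span ⟨u, hu, weightDeg_first, by rw [hw], rfl⟩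
  · rw [hw] at hlt
    exact absurd hlt wlt_irrefl
  · rw [hw] at hlt
    exact absurd (wlt_trans hlt wlt_second_third) wlt_irrefl

theorem polyLT_third_le :
    polyLT 5 31 [3, 4, 3, 1].toFinsupp ≤ hit 5 31 ⊔ polyLE 5 31 [3, 2, 2, 2].toFinsupp := by
  refine polyLT_le_hit_sup (by simp [List.toFinsupp_apply]) fun u hu hlt hw => ?_
  rcases hw with hw | hw | hw
  · exact subset_span ⟨u, hu, weightDeg_second, by
      rw [hw]; exact (show toLex _ < toLex _ from wlt_first_second).le, rfl⟩
  · exact subset_span ⟨u, hu, weightDeg_second, by rw [hw], rfl⟩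
  · rw [hw] at hlt
    exact absurd hlt wlt_irrefl

theorem monomial_mem_hit_sup_polyLE_third {u : Fin 5 →₀ ℕ} (hu : ∑ j, u j = 31)
    (h5 : wlt (weight u) (wcons 5 0)) :
    (MvPolynomial.monomial u 1 : Poly 5) ∈ hit 5 31 ⊔ polyLE 5 31 [3, 4, 3, 1].toFinsupp := by
  refine monomial_mem_of_forall (κ := wcons 5 0) le_sup_left (fun u hu hlt => ?_) u hu h5
  by_cases hw : weight u = [1, 1, 1, 1, 1].toFinsupp ∨ weight u = [3, 2, 2, 2].toFinsupp ∨
      weight u = [3, 4, 3, 1].toFinsupp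
  · refine .inl (mem_sup_right (subset_span ⟨u, hu, weightDeg_third, ?_, rfl⟩))
    rcases hw with hw | hw | hw <;> rw [hw]
    · exact (show toLex _ < toLex _ from wlt_trans wlt_first_second wlt_second_third).le
    · exact (show toLex _ < toLex _ from wlt_second_third).le
  · simp only [not_or] at hw
    exact .inr (monomial_mem_hitLower hu (weight_zero_lt_of_wlt hlt).ne hw.1 hw.2.1 hw.2.2)

theorem kamekoPoly_eq_zero_of_polyZero {t : ℕ} {F : Poly t} (hF : F ∈ polyZero t) :
    kamekoPoly t F = 0 := by
  refine (LinearMap.mem_ker.1 (span_le.2 ?_ hF) : kamekoPoly t F = 0)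
  rintro _ ⟨u, hu, rfl⟩
  obtain ⟨j, -, hj⟩ := Finset.prod_eq_zero_iff.1 hu
  exact kamekoPoly_eq_zero (weight_zero_lt fun h => by simpa [hj] using h j).ne

theorem zero_apply_le_of_toLex_le {η κ : ℕ →₀ ℕ} (h : toLex η ≤ toLex κ) : η 0 ≤ κ 0 := by
  rcases h.lt_or_eq with h | h
  · obtain ⟨k, hk, hk'⟩ : wlt η κ := h
    cases k with
    | zero => exact hk'.le
    | succ k => exact (hk 0 (Nat.succ_pos k)).le
  · exact le_of_eq (congrArg (fun f : ℕ →₀ ℕ => f 0) (toLex_inj.1 h))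

theorem kamekoPoly_eq_zero_of_polyLE {t n : ℕ} {η : ℕ →₀ ℕ} (hη : η 0 < t) {F : Poly t}
    (hF : F ∈ polyLE t n η) : kamekoPoly t F = 0 := by
  refine (LinearMap.mem_ker.1 (span_le.2 ?_ hF) : kamekoPoly t F = 0)
  rintro _ ⟨u, -, -, hle, rfl⟩
  exact kamekoPoly_eq_zero ((zero_apply_le_of_toLex_le hle).trans_lt hη).ne

/-- An element of the kernel reduces to monomials with ω₁ < 5 and then to the three weights, of
which (3,4,3,1) is the largest. Conversely, monomials with ω₁ < 5 have an even exponent and are sent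
to zero. -/
theorem ker_kameko_eq (h : 31 = 5 + 2 * 13) :
    LinearMap.ker (kameko 5 h) =
      QZero 5 31 ⊔ imageInQ 5 31 (polyLE 5 31 [3, 4, 3, 1].toFinsupp ⊓ polyPos 5) := by
  ext q
  obtain ⟨x, rfl⟩ := Submodule.mkQ_surjective _ q
  rw [LinearMap.mem_ker, kameko_toQ, QZero, imageInQ_sup, toQ_mem_imageInQ]
  constructor
  · intro hx
    have h1 : (x : Poly 5) ∈ hit 5 31 ⊔ polyLE 5 31 [3, 4, 3, 1].toFinsupp :=
      mem_of_mem_hitLower x.2 (mem_hitLower_of_kamekoPoly_mem h hx) le_sup_left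
        fun u hu hu' => monomial_mem_hit_sup_polyLE_third hu hu'
    obtain ⟨y, hy, F, hF, h2⟩ := mem_sup.1 h1
    rw [← h2]
    have hF31 := polyLE_le_homog _ _ _ hF
    refine add_mem_sup hy ⟨?_, hF31⟩
    rw [← sub_add_cancel F (posPart 5 F)]
    exact add_mem_sup ⟨sub_posPart_mem_polyZero F, sub_mem hF31 (posPart_homog hF31)⟩
      ⟨⟨posPart_polyLE hF, posPart_mem_polyPos F⟩, posPart_homog hF31⟩
  · intro hx
    obtain ⟨y, hy, z, ⟨hz, -⟩, hx⟩ := mem_sup.1 hx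
    obtain ⟨z₀, hz₀, z₁, hz₁, rfl⟩ := mem_sup.1 hz
    rw [← hx, map_add, map_add, kamekoPoly_eq_zero_of_polyZero hz₀.1,
      kamekoPoly_eq_zero_of_polyLE (by simp [List.toFinsupp_apply]) hz₁.1.1, add_zero, add_zero]
    exact kamekoPoly_hit 5 13 (h ▸ hy)

/-- Between consecutive exceptional weights the filtration does not grow (`e₂`, `e₃`), and below the
first it is zero (`e₁`), so three steps of `finrank_sup_imageInQ` reach Q⁰. -/
theorem finrank_ker_kameko (h : 31 = 5 + 2 * 13) :
    Module.finrank (ZMod 2) (LinearMap.ker (kameko 5 h)) =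
      Module.finrank (ZMod 2) (QZero 5 31) +
        Module.finrank (ZMod 2) (QWeightPos 5 31 [1, 1, 1, 1, 1].toFinsupp) +
        Module.finrank (ZMod 2) (QWeightPos 5 31 [3, 2, 2, 2].toFinsupp) +
        Module.finrank (ZMod 2) (QWeightPos 5 31 [3, 4, 3, 1].toFinsupp) := by
  have e₁ : imageInQ 5 31 (polyLT 5 31 [1, 1, 1, 1, 1].toFinsupp ⊓ polyPos 5) = ⊥ := by
    refine le_bot_iff.1 ((imageInQ_inf_polyPos_mono bot_le (fun F hF => ?_) polyLT_first_le).trans ?_)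
    · rw [mem_bot] at hF ⊢
      rw [hF, map_zero]
    · rw [bot_inf_eq]
      rintro q ⟨x, hx, rfl⟩
      rw [show x = 0 from Subtype.ext hx, map_zero]
      exact zero_mem _
  have e₂ : imageInQ 5 31 (polyLT 5 31 [3, 2, 2, 2].toFinsupp ⊓ polyPos 5) =
      imageInQ 5 31 (polyLE 5 31 [1, 1, 1, 1, 1].toFinsupp ⊓ polyPos 5) := by
    refine le_antisymm (imageInQ_inf_polyPos_mono (polyLE_le_homog _ _ _)
      (fun F hF => posPart_polyLE hF) polyLT_second_le) (Submodule.map_mono (Submodule.comap_mono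
        (inf_le_inf_right _ (span_le.2 ?_))))
    rintro _ ⟨u, hu, -, hle, rfl⟩
    exact subset_span ⟨u, hu, weightDeg_second,
      hle.trans_lt (show toLex _ < toLex _ from wlt_first_second), rfl⟩
  have e₃ : imageInQ 5 31 (polyLT 5 31 [3, 4, 3, 1].toFinsupp ⊓ polyPos 5) =
      imageInQ 5 31 (polyLE 5 31 [3, 2, 2, 2].toFinsupp ⊓ polyPos 5) := by
    refine le_antisymm (imageInQ_inf_polyPos_mono (polyLE_le_homog _ _ _)
      (fun F hF => posPart_polyLE hF) polyLT_third_le) (Submodule.map_mono (Submodule.comap_mono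
        (inf_le_inf_right _ (span_le.2 ?_))))
    rintro _ ⟨u, hu, -, hle, rfl⟩
    exact subset_span ⟨u, hu, weightDeg_third,
      hle.trans_lt (show toLex _ < toLex _ from wlt_second_third), rfl⟩
  rw [ker_kameko_eq, finrank_sup_imageInQ, e₃, finrank_sup_imageInQ, e₂, finrank_sup_imageInQ, e₁,
    sup_bot_eq]

theorem ker_kameko_inf_le (h : 31 = 5 + 2 * 13) {η : ℕ →₀ ℕ} (hη : weightDeg η = 31)
    (h₁ : η ≠ [1, 1, 1, 1, 1].toFinsupp) (h₂ : η ≠ [3, 2, 2, 2].toFinsupp)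
    (h₃ : η ≠ [3, 4, 3, 1].toFinsupp) :
    LinearMap.ker (kameko 5 h) ⊓ imageInQ 5 31 (polyLE 5 31 η) ≤
      imageInQ 5 31 (polyLT 5 31 η) := by
  have hinf : polyLT 5 31 η ⊓ homog 5 31 = polyLT 5 31 η :=
    inf_eq_left.2 ((polyLT_le_polyLE _ _ _).trans (polyLE_le_homog _ _ _))
  -- If η₁ < 5, monomials of weight η are themselves hit modulo lower weights, whether or not the
  -- class is in the kernel. Otherwise the kernel condition supplies a representative with ω₁ < 5,
  -- hence below η.
  by_cases h5 : η 0 < 5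
  · refine inf_le_right.trans (imageInQ_mono (inf_le_left.trans ?_))
    rw [hinf]
    refine span_le.2 ?_
    rintro _ ⟨u, hu, -, hle, rfl⟩
    rcases hle.lt_or_eq with hlt | heq
    · exact mem_sup_right (subset_span ⟨u, hu, hη, hlt, rfl⟩)
    · obtain rfl : weight u = η := toLex_inj.1 heq
      exact mem_of_mem_hitLower (monomial_homog hu) (monomial_mem_hitLower hu h5.ne h₁ h₂ h₃)
        le_sup_left fun v hv hvu => mem_sup_right (subset_span ⟨v, hv, hη, hvu, rfl⟩)
  · refine inf_le_left.trans fun q hq => ?_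
    obtain ⟨x, rfl⟩ := Submodule.mkQ_surjective _ q
    rw [LinearMap.mem_ker, kameko_toQ] at hq
    rw [toQ_mem_imageInQ, hinf]
    refine mem_of_mem_hitLower x.2 (mem_hitLower_of_kamekoPoly_mem h hq) le_sup_left
      fun u hu hu' => mem_sup_right (subset_span ⟨u, hu, hη, ?_, rfl⟩)
    have := weight_zero_lt_of_wlt hu'
    exact (⟨0, fun i hi => absurd hi (Nat.not_lt_zero i), by omega⟩ : wlt (weight u) η)

end HitProblem
end

theorem mainTheorem3 (ω : Fin 3 → ℕ →₀ ℕ)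
    (hω : ω = ![[1, 1, 1, 1, 1].toFinsupp, [3, 2, 2, 2].toFinsupp, [3, 4, 3, 1].toFinsupp])
    (Sq0 : HitProblem.Q 5 31 →ₗ[ZMod 2] HitProblem.Q 5 13)
    (hSq0 : Sq0 = HitProblem.kameko 5 (by norm_num)) :
    Function.Surjective Sq0 ∧
    Nonempty (LinearMap.ker Sq0 ≃ₗ[ZMod 2]
      (HitProblem.QZero 5 31 × ⨁ j : Fin 3, HitProblem.QWeightPos 5 31 (ω j))) ∧
    ∀ η : ℕ →₀ ℕ, HitProblem.weightDeg η = 31 → (∀ j, η ≠ ω j) →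
      LinearMap.ker Sq0 ⊓ HitProblem.imageInQ 5 31 (HitProblem.polyLE 5 31 η) ≤
        HitProblem.imageInQ 5 31 (HitProblem.polyLT 5 31 η) := by
  subst hSq0
  refine ⟨HitProblem.kameko_surjective _, ?_, fun η hη hne => ?_⟩
  · have h1 : ∀ j, Module.Free (ZMod 2) (HitProblem.QWeightPos 5 31 (ω j)) :=
      fun j => Module.Free.of_divisionRing _ _
    have h2 : Module.Free (ZMod 2) (⨁ j : Fin 3, HitProblem.QWeightPos 5 31 (ω j)) := inferInstance
    have h3 : Module.Free (ZMod 2) (HitProblem.QZero 5 31) := Module.Free.of_divisionRing _ _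
    refine FiniteDimensional.nonempty_linearEquiv_of_finrank_eq ?_
    rw [HitProblem.finrank_ker_kameko, Module.finrank_prod, Module.finrank_directSum,
      Fin.sum_univ_three, hω, add_assoc, add_assoc, add_assoc]
    rfl
  · subst hω
    exact HitProblem.ker_kameko_inf_le _ hη (hne 0) (hne 1) (hne 2)
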